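/- Let $L^2_{\mathrm{o,p}}(-\pi,\pi)$ be the real Hilbert space of odd $2\pi$-periodic square-integrable functions with $(f,g)=\int_{-\pi}^{\pi}fg\,dx$. For $\alpha=\beta/4\pi>0$ let $Az=-\alpha z''-2z$, with domain $D(A)=\{z\in L^2_{\mathrm{o,p}}:Az\in L^2_{\mathrm{o,p}}\}$ (periodic distributional derivatives), and $F(z)=-2\alpha z'z$. Its eigenfunctions are $\phi_n(x)=\pi^{-1/2}\sin nx$, $n\ge 1$, with eigenvalues $\alpha n^2-2$. Let $\mathcal B^{1/2}=D(A_1^{1/2})=H^1_{\mathrm{o,p}}(-\pi,\pi)$ with the graph norm $\|f\|_{1/2}=\|A_1^{1/2}f\|_{L^2}=\big(\sum_{n\ge1}(\alpha_* n^2-2+a)(f,\phi_n)^2\big)^{1/2}$ of the positive definite operator $A_1=-\alpha_*\,d^2/dx^2-2+a$, where $\alpha_*>0$ and $a>2-\alpha_*$ are fixed but arbitrary (the space does not depend on this choice, and all these norms are equivalent). A solution of the initial value problem $$\frac{dz}{dt}+Az=F(z),\qquad z(0)=z_0,$$ is a continuous map $z:[0,\infty)\to\mathcal B^{1/2}$ with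 $z(0)=z_0$ such that for every $t>0$ one has $z(t)\in D(A)$, $z$ is differentiable at $t$ as an $L^2$-valued map, and the equation holds at $t$ in $L^2$. **Theorem.** For every $\alpha>0$ and $z_0\in\mathcal B^{1/2}$ the initial value problem has a unique solution $t\mapsto z(t;\alpha,z_0)$ on $[0,\infty)$, and for every $t\ge 0$ the map $$(0,\infty)\times\mathcal B^{1/2}\to\mathcal B^{1/2},\qquad(\alpha,z_0)\mapsto z(t;\alpha,z_0),$$ is (jointly) continuous. -/

import Mathlib

open MeasureTheory Filter Topology
open scoped ContDiff

noncomputable section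

namespace HierCoulomb

/-- Lebesgue measure on the period interval `(-π, π]`. -/
abbrev period : Measure ℝ := volume.restrict (Set.Ioc (-Real.pi) Real.pi)

/-- The real Hilbert space `L²(-π, π)`, with `(f, g) = ∫_{-π}^{π} f g dx`. -/
abbrev L2 : Type := Lp ℝ 2 period

/-- `f` is odd (almost everywhere), i.e. `f` belongs to `L²_{o,p}(-π, π)`. -/
def IsOdd (f : L2) : Prop := ∀ᵐ x ∂period, f (-x) = -f x

/-- `g` is the distributional derivative of `f` as a `2π`-periodic function: the test functions
are all smooth `2π`-periodic functions. -/
def HasWeakDeriv (f g : L2) : Prop :=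
  ∀ φ : ℝ → ℝ, ContDiff ℝ ∞ φ → Function.Periodic φ (2 * Real.pi) →
    ∫ x, f x * deriv φ x ∂period = -∫ x, g x * φ x ∂period

/-- The graph of the self-adjoint operator `A z = -α z'' - 2 z` in `L²_{o,p}(-π, π)`, with domain
`D(A) = {z ∈ L²_{o,p} : A z ∈ L²_{o,p}}` (derivatives in the distributional periodic sense):
`OpA α z w` says that `z ∈ D(A)` and `A z = w`. -/
def OpA (α : ℝ) (z w : L2) : Prop :=
  IsOdd z ∧ ∃ z₁ z₂ : L2, HasWeakDeriv z z₁ ∧ HasWeakDeriv z₁ z₂ ∧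
    w = -(α • z₂) - (2 : ℝ) • z

/-- The nonlinearity `F(z) = -2 α z' z`: `NonlinF α z w` says that `z` has a distributional
derivative in `L²`, that `-2 α z' z` is in `L²`, and that `F(z) = w`. -/
def NonlinF (α : ℝ) (z w : L2) : Prop :=
  ∃ z₁ : L2, HasWeakDeriv z z₁ ∧ ∀ᵐ x ∂period, w x = -2 * α * z₁ x * z x

/-- The coefficient `(f, φₙ₊₁)` of `f` on the normalized eigenfunction
`φₙ₊₁(x) = π^{-1/2} sin((n+1)x)` of `A`. -/
def sineCoeff (f : L2) (n : ℕ) : ℝ :=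
  ∫ x, f x * (Real.sin ((n + 1 : ℝ) * x) / √Real.pi) ∂period

/-- The eigenvalue `α (n+1)² - 2 + a` of `A₁ = A + a I` on the eigenfunction `φₙ₊₁`. -/
def eigenvalue (α a : ℝ) (n : ℕ) : ℝ := α * (n + 1 : ℝ) ^ 2 - 2 + a

/-- `𝓑^γ = D(A₁^γ)`, where `A₁ = A + a I` is positive definite, i.e. `a > 2 - α`. Since `A₁` is
diagonal in the orthonormal basis `φ₁, φ₂, …` of `L²_{o,p}`, so is `A₁^γ`. -/
def fracSpace (α a γ : ℝ) : Set L2 :=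
  {f | IsOdd f ∧ Summable fun n : ℕ => (eigenvalue α a n ^ γ * sineCoeff f n) ^ 2}

/-- The graph norm `‖f‖_γ = ‖A₁^γ f‖_{L²}` on `𝓑^γ`. -/
def fracNorm (α a γ : ℝ) (f : L2) : ℝ :=
  √(∑' n : ℕ, (eigenvalue α a n ^ γ * sineCoeff f n) ^ 2)

/-- `z` (only its values at `t ≥ 0` matter) is a solution on `[0, ∞)` of the initial value problem
`dz/dt + A z = F(z)`, `z(0) = z₀`, with parameter `α`: it is continuous into `𝓑^{1/2}`, and for
`t > 0` it lies in `D(A)`, is differentiable in `L²` and satisfies the equation. The parameters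
`αr`, `a` only fix the operator `A₁` that is used to describe `𝓑^{1/2}`. -/
structure IsSolution (αr a α : ℝ) (z₀ : L2) (z : ℝ → L2) : Prop where
  mem : ∀ t, 0 ≤ t → z t ∈ fracSpace αr a (1 / 2)
  continuous : ∀ t, 0 ≤ t →
    Tendsto (fun s => fracNorm αr a (1 / 2) (z s - z t)) (𝓝[Set.Ici 0] t) (𝓝 0)
  initial : z 0 = z₀
  equation : ∀ t, 0 < t → ∃ Az Fz : L2,
    OpA α (z t) Az ∧ NonlinF α (z t) Fz ∧ HasDerivAt z (Fz - Az) t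

end HierCoulomb

end

open HierCoulomb

namespace HierCoulomb

/-! The substitution z(t) = e^{2t} w(αt) removes the term 2z and leaves a viscous Burgers equation
w_τ = w_xx - 2 c(τ) w w_x with c(τ) = e^{2τ/α}, so that α survives only in a scalar coefficient and
in the time scale. An odd H¹ function is encoded by x in ℓ² through `sineSeries (divFreq x)`: then
‖x‖ is the L² norm of the derivative and ‖divFreq x‖ that of the function. Since H¹ embeds into the
bounded continuous functions, -2 w w_x becomes a bounded bilinear map B on ℓ² (`burgers`), and the
equation reads vₙ' = -(n+1)² vₙ + (n+1) c B(v, v)ₙ (`IsFlow`).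

Dissipation absorbs the unbounded factor n + 1: the heat equation with source (n+1) gₙ satisfies
‖u(t)‖² ≤ ‖u(0)‖² + ∫ ‖g‖² (`SolvesHeat.energy`). Picard iteration therefore solves the equation
whenever the nonlinearity is Lipschitz, in particular after B is truncated.

Blow-up is excluded because the Burgers term does no work in L², as ∫ w² w_x = 0
(`inner_divFreq_burgers`). Hence 2 ∫ ‖v‖² ≤ ‖v(0)‖², and Gronwall with the integrable rate ‖B‖² c²
‖v‖² bounds ‖v‖ for all times (`IsFlow.norm_sq_le`). The bound does not see the truncation, which is
thus inactive (`exists_isFlow`).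

A flow gains a derivative at positive times (`IsFlow.exists_regular`), so it yields a solution in
the required sense (`isSolution_waveform`). Conversely, the sine coefficients of any solution form a
flow (`IsSolution.exists_isFlow`), so uniqueness and continuous dependence reduce to a Gronwall
estimate for the difference of two flows (`IsFlow.norm_sub_sq_le`, `tendsto_flow`). -/

/-- Square-summable real sequences. -/
abbrev Seq : Type := lp (fun _ : ℕ => ℝ) 2

/-- The wave number `n + 1` of the `n`-th mode. -/
def freq (n : ℕ) : ℝ := n + 1

theorem freq_pos (n : ℕ) : 0 < freq n := by unfold freq; positivity

theorem one_le_freq (n : ℕ) : 1 ≤ freq n := by unfold freq; simp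

theorem freq_ne_zero (n : ℕ) : freq n ≠ 0 := (freq_pos n).ne'

/-! ### The coefficient space ℓ². -/

namespace Seq

theorem hasSum_sq (x : Seq) : HasSum (fun n => x n ^ 2) (‖x‖ ^ 2) := by
  have h := lp.hasSum_inner (𝕜 := ℝ) x x
  rw [real_inner_self_eq_norm_sq] at h
  simpa [pow_two] using h

theorem memlp_of_summable {x : ℕ → ℝ} (h : Summable fun n => x n ^ 2) :
    Memℓp (E := fun _ : ℕ => ℝ) x 2 := by
  apply memℓp_gen
  simpa using h

/-- The element of `Seq` with given square-summable entries. -/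
def mk (x : ℕ → ℝ) (h : Summable fun n => x n ^ 2) : Seq := ⟨x, memlp_of_summable h⟩

@[simp] theorem mk_apply (x : ℕ → ℝ) (h : Summable fun n => x n ^ 2) (n : ℕ) : mk x h n = x n := rfl

theorem add_apply (x y : Seq) (n : ℕ) : (x + y) n = x n + y n := rfl

theorem sub_apply (x y : Seq) (n : ℕ) : (x - y) n = x n - y n := rfl

theorem smul_apply (c : ℝ) (x : Seq) (n : ℕ) : (c • x) n = c * x n := rfl

theorem sum_sq_le (x : Seq) (s : Finset ℕ) : ∑ n ∈ s, x n ^ 2 ≤ ‖x‖ ^ 2 :=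
  sum_le_hasSum s (fun _ _ => sq_nonneg _) x.hasSum_sq

theorem norm_sq_le_of_sq_le {x : Seq} {a : ℕ → ℝ} (ha : Summable a) (h : ∀ n, x n ^ 2 ≤ a n) :
    ‖x‖ ^ 2 ≤ ∑' n, a n :=
  hasSum_le h x.hasSum_sq ha.hasSum

/-- The `n`-th entry as a continuous linear functional. -/
noncomputable def eval (n : ℕ) : Seq →L[ℝ] ℝ := lp.evalCLM ℝ (fun _ : ℕ => ℝ) 2 n

theorem continuous_apply (n : ℕ) : Continuous fun x : Seq => x n := (eval n).continuous

/-- Dominated convergence for ∑ (uₙ(r) - uₙ(t))², with majorant 4aₙ because (p - q)² ≤ 2p² + 2q².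
This is how control of single modes becomes continuity in norm. -/
theorem continuousOn_of_dominated {s : Set ℝ} {u : ℝ → Seq} {a : ℕ → ℝ} (ha : Summable a)
    (hle : ∀ t ∈ s, ∀ n, u t n ^ 2 ≤ a n) (hc : ∀ n, ContinuousOn (fun t => u t n) s) :
    ContinuousOn u s := by
  intro t ht
  have key : Tendsto (fun r => ∑' n, (u r n - u t n) ^ 2) (𝓝[s] t)
      (𝓝 (∑' n, (u t n - u t n) ^ 2)) := by
    refine tendsto_tsum_of_dominated_convergence (bound := fun n => 4 * a n) (ha.mul_left 4) ?_ ?_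
    · intro n
      exact ((hc n t ht).sub tendsto_const_nhds).pow 2
    · filter_upwards [self_mem_nhdsWithin] with r hr n
      rw [Real.norm_eq_abs, abs_of_nonneg (sq_nonneg _)]
      nlinarith [hle r hr n, hle t ht n, sq_nonneg (u r n + u t n)]
  have h2 : ∀ r, ∑' n, (u r n - u t n) ^ 2 = ‖u r - u t‖ ^ 2 := fun r =>
    (Seq.hasSum_sq (u r - u t)).tsum_eq
  simp only [h2, sub_self] at key
  have h3 := key.sqrt
  simp only [Real.sqrt_sq (norm_nonneg _)] at h3
  rw [ContinuousWithinAt, tendsto_iff_norm_sub_tendsto_zero]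
  simpa using h3

end Seq

/-! ### The linear heat equation, mode by mode. -/

/-- Energy identity for one mode of the heat equation with source, as an inequality. -/
theorem mode_energy {κ a b : ℝ} {u g : ℝ → ℝ} (hab : a ≤ b) (hu : ContinuousOn u (Set.Icc a b))
    (hg : ContinuousOn g (Set.Icc a b))
    (hd : ∀ t ∈ Set.Ioo a b, HasDerivAt u (-κ ^ 2 * u t + κ * g t) t) :
    u b ^ 2 + ∫ t in a..b, κ ^ 2 * u t ^ 2 ≤ u a ^ 2 + ∫ t in a..b, g t ^ 2 := by
  have hcd : ContinuousOn (fun t => 2 * u t * (-κ ^ 2 * u t + κ * g t)) (Set.Icc a b) := by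
    fun_prop
  have hftc : ∫ t in a..b, 2 * u t * (-κ ^ 2 * u t + κ * g t) = u b ^ 2 - u a ^ 2 := by
    refine intervalIntegral.integral_eq_sub_of_hasDerivAt_of_le (f := fun t => u t ^ 2) hab
      (hu.pow 2) ?_ (hcd.intervalIntegrable_of_Icc hab)
    intro t ht
    have := (hd t ht).pow 2
    refine this.congr_deriv ?_
    ring
  have h1 : ContinuousOn (fun t => κ ^ 2 * u t ^ 2) (Set.Icc a b) := by fun_prop
  have h2 : ContinuousOn (fun t => g t ^ 2) (Set.Icc a b) := by fun_prop
  have hle : ∫ t in a..b, 2 * u t * (-κ ^ 2 * u t + κ * g t)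
      ≤ ∫ t in a..b, (g t ^ 2 - κ ^ 2 * u t ^ 2) := by
    refine intervalIntegral.integral_mono_on hab (hcd.intervalIntegrable_of_Icc hab)
      ((h2.sub h1).intervalIntegrable_of_Icc hab) fun t _ => ?_
    -- Young's inequality 2κug ≤ κ²u² + g² spends half of the dissipation 2κ²u² on the source and
    -- keeps the other half.
    nlinarith [sq_nonneg (κ * u t - g t)]
  rw [hftc, intervalIntegral.integral_sub (h2.intervalIntegrable_of_Icc hab)
    (h1.intervalIntegrable_of_Icc hab)] at hle
  linarith

/-- Sums of the integrated squares of the entries of a continuous `Seq`-valued map. -/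
theorem sum_integral_sq_le {a b : ℝ} (hab : a ≤ b) {g : ℝ → Seq} (hg : Continuous g)
    (s : Finset ℕ) :
    ∑ n ∈ s, ∫ t in a..b, g t n ^ 2 ≤ ∫ t in a..b, ‖g t‖ ^ 2 := by
  have hc : ∀ n, Continuous fun t => g t n := fun n => (Seq.continuous_apply n).comp hg
  have h1 : ∫ t in a..b, ∑ n ∈ s, g t n ^ 2 = ∑ n ∈ s, ∫ t in a..b, g t n ^ 2 :=
    intervalIntegral.integral_finsetSum fun n _ => ((hc n).pow 2).intervalIntegrable a b
  rw [← h1]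
  refine intervalIntegral.integral_mono_on hab ?_ ((hg.norm.pow 2).intervalIntegrable a b)
    fun t _ => (g t).sum_sq_le s
  exact (continuous_finsetSum _ fun n _ => (hc n).pow 2).intervalIntegrable a b

theorem summable_integral_sq {a b : ℝ} (hab : a ≤ b) {g : ℝ → Seq} (hg : Continuous g) :
    Summable fun n => ∫ t in a..b, g t n ^ 2 :=
  summable_of_sum_le (fun _ => intervalIntegral.integral_nonneg hab fun _ _ => sq_nonneg _)
    (sum_integral_sq_le hab hg)

theorem tsum_integral_sq_le {a b : ℝ} (hab : a ≤ b) {g : ℝ → Seq} (hg : Continuous g) :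
    ∑' n, ∫ t in a..b, g t n ^ 2 ≤ ∫ t in a..b, ‖g t‖ ^ 2 :=
  (summable_integral_sq hab hg).tsum_le_of_sum_le (sum_integral_sq_le hab hg)

/-- `u` solves the heat equation `uₙ' = -(n+1)² uₙ + (n+1) gₙ` for positive times. -/
def SolvesHeat (g u : ℝ → Seq) : Prop :=
  ∀ t, 0 < t → ∀ n, HasDerivAt (fun s => u s n) (-freq n ^ 2 * u t n + freq n * g t n) t

theorem SolvesHeat.mode_energy {g u : ℝ → Seq} (h : SolvesHeat g u) (hg : Continuous g)
    (hu : Continuous u) {t : ℝ} (ht : 0 ≤ t) (n : ℕ) :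
    u t n ^ 2 + ∫ s in (0 : ℝ)..t, freq n ^ 2 * u s n ^ 2 ≤
      u 0 n ^ 2 + ∫ s in (0 : ℝ)..t, g s n ^ 2 :=
  HierCoulomb.mode_energy ht ((Seq.continuous_apply n).comp hu).continuousOn
    ((Seq.continuous_apply n).comp hg).continuousOn fun s hs => h s hs.1 n

theorem SolvesHeat.energy {g u : ℝ → Seq} (h : SolvesHeat g u) (hg : Continuous g)
    (hu : Continuous u) {t : ℝ} (ht : 0 ≤ t) :
    ‖u t‖ ^ 2 ≤ ‖u 0‖ ^ 2 + ∫ s in (0 : ℝ)..t, ‖g s‖ ^ 2 := by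
  have hs := (Seq.hasSum_sq (u 0)).summable
  have h2 := summable_integral_sq ht hg
  have h3 := Seq.norm_sq_le_of_sq_le (x := u t) (hs.add h2) fun n => by
    have h4 := h.mode_energy hg hu ht n
    have h5 : 0 ≤ ∫ s in (0 : ℝ)..t, freq n ^ 2 * u s n ^ 2 :=
      intervalIntegral.integral_nonneg ht fun _ _ => by positivity
    linarith
  rw [hs.tsum_add h2, (Seq.hasSum_sq (u 0)).tsum_eq] at h3
  linarith [tsum_integral_sq_le ht hg]

/-- The half of the dissipation kept in the mode estimate: one more derivative is square integrable
in time. Parabolic smoothing starts from this. -/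
theorem SolvesHeat.summable_dissipation {g u : ℝ → Seq} (h : SolvesHeat g u) (hg : Continuous g)
    (hu : Continuous u) {t : ℝ} (ht : 0 ≤ t) :
    Summable fun n => ∫ s in (0 : ℝ)..t, freq n ^ 2 * u s n ^ 2 := by
  refine Summable.of_nonneg_of_le
    (fun n => intervalIntegral.integral_nonneg ht fun _ _ => by positivity) (fun n => ?_)
    ((Seq.hasSum_sq (u 0)).summable.add (summable_integral_sq ht hg))
  linarith [h.mode_energy hg hu ht n, sq_nonneg (u t n)]

theorem SolvesHeat.sub {g g' u u' : ℝ → Seq} (h : SolvesHeat g u) (h' : SolvesHeat g' u') :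
    SolvesHeat (fun t => g t - g' t) (fun t => u t - u' t) := by
  intro t ht n
  refine ((h t ht n).sub (h' t ht n)).congr_deriv ?_
  simp only [Seq.sub_apply]
  ring

/-- The heat equation with a continuous source is solvable. -/
theorem exists_solvesHeat (u₀ : Seq) {g : ℝ → Seq} (hg : Continuous g) :
    ∃ u : ℝ → Seq, Continuous u ∧ (∀ t ≤ 0, u t = u₀) ∧ SolvesHeat g u := by
  have hgc : ∀ n, Continuous fun t => g t n := fun n => (Seq.continuous_apply n).comp hg
  -- Duhamel's formula in each mode.
  set w : ℝ → ℕ → ℝ := fun t n =>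
    Real.exp (-freq n ^ 2 * t) * (u₀ n + ∫ s in (0 : ℝ)..t, Real.exp (freq n ^ 2 * s) *
      (freq n * g s n)) with hw
  have hic : ∀ n, Continuous fun s => Real.exp (freq n ^ 2 * s) * (freq n * g s n) := fun n => by
    have := hgc n
    fun_prop
  have hwd : ∀ t n, HasDerivAt (fun s => w s n) (-freq n ^ 2 * w t n + freq n * g t n) t := by
    intro t n
    have h1 : HasDerivAt (fun s => u₀ n + ∫ s in (0 : ℝ)..s, Real.exp (freq n ^ 2 * s) *
        (freq n * g s n)) (Real.exp (freq n ^ 2 * t) * (freq n * g t n)) t :=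
      ((hic n).integral_hasStrictDerivAt 0 t).hasDerivAt.const_add _
    have h2 : HasDerivAt (fun s => Real.exp (-freq n ^ 2 * s))
        (Real.exp (-freq n ^ 2 * t) * (-freq n ^ 2)) t := by
      simpa using ((hasDerivAt_id t).const_mul (-freq n ^ 2)).exp
    refine (h2.mul h1).congr_deriv ?_
    have h3 : Real.exp (-freq n ^ 2 * t) * Real.exp (freq n ^ 2 * t) = 1 := by
      rw [← Real.exp_add]; simp
    simp only [hw]
    linear_combination (freq n * g t n) * h3
  have hw0 : ∀ n, w 0 n = u₀ n := fun n => by simp [hw]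
  have hwc : ∀ n, Continuous fun t => w t n := fun n =>
    continuous_iff_continuousAt.2 fun t => (hwd t n).continuousAt
  -- Freezing time at `max t 0` makes the solution constant for negative times, so that it is a
  -- continuous function on the whole line.
  have hbd : ∀ T, 0 ≤ T → ∀ t ∈ Set.Iic T, ∀ n,
      w (max t 0) n ^ 2 ≤ u₀ n ^ 2 + ∫ s in (0 : ℝ)..T, g s n ^ 2 := by
    intro T hT t ht n
    have h0 : (0 : ℝ) ≤ max t 0 := le_max_right _ _
    have hmT : max t 0 ≤ T := max_le ht hT
    have h1 := HierCoulomb.mode_energy h0 (hwc n).continuousOn (hgc n).continuousOn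
      fun s _ => hwd s n
    have h2 : 0 ≤ ∫ s in (0 : ℝ)..max t 0, freq n ^ 2 * w s n ^ 2 :=
      intervalIntegral.integral_nonneg h0 fun _ _ => by positivity
    have h3 : ∫ s in (0 : ℝ)..max t 0, g s n ^ 2 ≤ ∫ s in (0 : ℝ)..T, g s n ^ 2 :=
      intervalIntegral.integral_mono_interval le_rfl h0 hmT
        (Eventually.of_forall fun _ => sq_nonneg _) (((hgc n).pow 2).intervalIntegrable _ _)
    rw [hw0] at h1
    linarith
  have hsum : ∀ T, 0 ≤ T → Summable fun n => u₀ n ^ 2 + ∫ s in (0 : ℝ)..T, g s n ^ 2 :=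
    fun T hT => u₀.hasSum_sq.summable.add (summable_integral_sq hT hg)
  have hws : ∀ t, Summable fun n => w (max t 0) n ^ 2 := fun t =>
    Summable.of_nonneg_of_le (fun n => sq_nonneg _)
      (hbd (max t 0) (le_max_right _ _) t (Set.mem_Iic.2 (le_max_left _ _))) (hsum _ (le_max_right _ _))
  refine ⟨fun t => Seq.mk _ (hws t), ?_, ?_, ?_⟩
  · refine continuous_iff_continuousAt.2 fun t => ?_
    have hT : 0 ≤ |t| + 1 := by positivity
    have h := Seq.continuousOn_of_dominated (s := Set.Iic (|t| + 1))
      (u := fun t => Seq.mk _ (hws t)) (hsum _ hT) (hbd _ hT)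
      fun n => ((hwc n).comp (continuous_id.max continuous_const)).continuousOn
    exact h.continuousAt (Iic_mem_nhds (by linarith [le_abs_self t]))
  · intro t ht
    ext n
    simp [max_eq_right ht, hw0]
  · intro t ht n
    have h := hwd t n
    have he : (fun s => Seq.mk _ (hws s) n) =ᶠ[𝓝 t] fun s => w s n := by
      filter_upwards [lt_mem_nhds ht] with s hs
      simp [max_eq_left hs.le]
    refine (h.congr_of_eventuallyEq he).congr_deriv ?_
    simp [max_eq_left ht.le]

/-! ### Gronwall's inequality and Picard iteration for Lipschitz nonlinearities. -/

/-- Gronwall's inequality in integral form. -/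
theorem le_mul_exp_of_le_add_integral {y q : ℝ → ℝ} {C T : ℝ} (hy : Continuous y)
    (hq : Continuous q) (hq0 : ∀ t, 0 ≤ q t) (hT : 0 ≤ T)
    (h : ∀ t ∈ Set.Icc 0 T, y t ≤ C + ∫ s in (0 : ℝ)..t, q s * y s) :
    y T ≤ C * Real.exp (∫ s in (0 : ℝ)..T, q s) := by
  set R : ℝ → ℝ := fun t => C + ∫ s in (0 : ℝ)..t, q s * y s with hR
  set P : ℝ → ℝ := fun t => ∫ s in (0 : ℝ)..t, q s with hP
  have hRd : ∀ t, HasDerivAt R (q t * y t) t := fun t =>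
    ((hq.mul hy).integral_hasStrictDerivAt 0 t).hasDerivAt.const_add _
  have hPd : ∀ t, HasDerivAt P (q t) t := fun t =>
    (hq.integral_hasStrictDerivAt 0 t).hasDerivAt
  have hG : ∀ t, HasDerivAt (fun t => R t * Real.exp (-P t))
      (q t * y t * Real.exp (-P t) + R t * (Real.exp (-P t) * -q t)) t := fun t =>
    (hRd t).mul (hPd t).neg.exp
  -- The derivative of R e^{-P} is q (y - R) e^{-P}, and y ≤ R by hypothesis.
  have hanti : AntitoneOn (fun t => R t * Real.exp (-P t)) (Set.Icc 0 T) := by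
    refine antitoneOn_of_deriv_nonpos (convex_Icc 0 T)
      (fun t _ => (hG t).continuousAt.continuousWithinAt)
      (fun t _ => (hG t).differentiableAt.differentiableWithinAt) fun t ht => ?_
    rw [interior_Icc] at ht
    rw [(hG t).deriv]
    have h1 : q t * (R t - y t) * Real.exp (-P t) ≥ 0 :=
      mul_nonneg (mul_nonneg (hq0 t) (sub_nonneg.2 (h t ⟨ht.1.le, ht.2.le⟩))) (Real.exp_pos _).le
    linarith
  have h2 := hanti (Set.left_mem_Icc.2 hT) (Set.right_mem_Icc.2 hT) hT
  simp only [hR, hP, intervalIntegral.integral_same, add_zero, neg_zero, Real.exp_zero,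
    mul_one] at h2
  calc y T ≤ R T := h T (Set.right_mem_Icc.2 hT)
    _ = R T * Real.exp (-P T) * Real.exp (P T) := by
      rw [mul_assoc, ← Real.exp_add]; simp
    _ ≤ C * Real.exp (P T) := mul_le_mul_of_nonneg_right h2 (Real.exp_pos _).le

/-- The weight that turns the Picard map into a contraction. -/
noncomputable def picardWeight (L : ℝ → ℝ) (t : ℝ) : ℝ := Real.exp (2 * max t 0 * L t ^ 2)

theorem picardWeight_pos (L : ℝ → ℝ) (t : ℝ) : 0 < picardWeight L t := Real.exp_pos _

theorem one_le_picardWeight (L : ℝ → ℝ) (t : ℝ) : 1 ≤ picardWeight L t :=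
  Real.one_le_exp (by have := le_max_right t 0; positivity)

theorem continuous_picardWeight {L : ℝ → ℝ} (hL : Continuous L) :
    Continuous (picardWeight L) := by
  unfold picardWeight
  fun_prop

/-- By monotonicity L(s) may be replaced by L(t), and the integral of L(t)² e^{4 L(t)² s} is
explicit. The factor 1/4 becomes the contraction constant 1/2 after a square root. -/
theorem integral_picardWeight_le {L : ℝ → ℝ} (hL : Continuous L) (hmono : Monotone L)
    (h0 : ∀ t, 0 ≤ L t) {t : ℝ} (ht : 0 ≤ t) :
    ∫ s in (0 : ℝ)..t, L s ^ 2 * picardWeight L s ^ 2 ≤ picardWeight L t ^ 2 / 4 := by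
  have hd : ∀ s, HasDerivAt (fun s => Real.exp (4 * L t ^ 2 * s) / 4)
      (L t ^ 2 * Real.exp (4 * L t ^ 2 * s)) s := fun s => by
    have := (((hasDerivAt_id s).const_mul (4 * L t ^ 2)).exp).div_const 4
    refine this.congr_deriv ?_
    simp only [id]
    ring
  have hc : Continuous fun s => L t ^ 2 * Real.exp (4 * L t ^ 2 * s) := by fun_prop
  have h1 := intervalIntegral.integral_eq_sub_of_hasDerivAt (fun s _ => hd s)
    (hc.intervalIntegrable 0 t)
  have h2 : ∫ s in (0 : ℝ)..t, L s ^ 2 * picardWeight L s ^ 2 ≤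
      ∫ s in (0 : ℝ)..t, L t ^ 2 * Real.exp (4 * L t ^ 2 * s) := by
    refine intervalIntegral.integral_mono_on ht
      (((hL.pow 2).mul ((continuous_picardWeight hL).pow 2)).intervalIntegrable _ _)
      (hc.intervalIntegrable _ _) fun s hs => ?_
    have h3 : L s ^ 2 ≤ L t ^ 2 := pow_le_pow_left₀ (h0 s) (hmono hs.2) 2
    have h4 : picardWeight L s ^ 2 ≤ Real.exp (4 * L t ^ 2 * s) := by
      rw [picardWeight, max_eq_left hs.1, ← Real.exp_nat_mul]
      apply Real.exp_le_exp.2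
      push_cast
      nlinarith [hs.1]
    exact mul_le_mul h3 h4 (sq_nonneg _) (sq_nonneg _)
  have h5 : picardWeight L t ^ 2 = Real.exp (4 * L t ^ 2 * t) := by
    rw [picardWeight, max_eq_left ht, ← Real.exp_nat_mul]
    congr 1
    push_cast
    ring
  rw [h1] at h2
  rw [h5]
  simp only [mul_zero, Real.exp_zero] at h2
  linarith

/-- The semilinear heat equation with a nonlinearity that is Lipschitz continuous, locally
uniformly in time, has global solutions. -/
theorem exists_solvesHeat_of_lipschitz {N : ℝ → Seq → Seq} {L : ℝ → ℝ}
    (hN : Continuous fun p : ℝ × Seq => N p.1 p.2) (hN0 : ∀ t, N t 0 = 0) (hL : Continuous L)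
    (hmono : Monotone L) (hL0 : ∀ t, 0 ≤ L t)
    (hLip : ∀ t, 0 ≤ t → ∀ x y, ‖N t x - N t y‖ ≤ L t * ‖x - y‖) (u₀ : Seq) :
    ∃ u : ℝ → Seq, Continuous u ∧ u 0 = u₀ ∧ SolvesHeat (fun t => N t (u t)) u := by
  set W := picardWeight L with hW
  have hWc : Continuous W := continuous_picardWeight hL
  have hWpos : ∀ t, 0 < W t := picardWeight_pos L
  choose! S hSc hS0 hS using fun (g : ℝ → Seq) (hg : Continuous g) => exists_solvesHeat u₀ hg
  -- The energy estimate for the difference of two iterates, whose initial values cancel, gives the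
  -- factor 1/2 in the weighted sup norm.
  have hdiff : ∀ (v w : ℝ → Seq), Continuous v → Continuous w → ∀ d, 0 ≤ d →
      (∀ t, ‖v t - w t‖ ≤ d * W t) → ∀ t,
      ‖S (fun t => N t (v t)) t - S (fun t => N t (w t)) t‖ ≤ d / 2 * W t := by
    intro v w hv hw d hd hvw t
    have hNv : Continuous fun t => N t (v t) := hN.comp (continuous_id.prodMk hv)
    have hNw : Continuous fun t => N t (w t) := hN.comp (continuous_id.prodMk hw)
    rcases le_total t 0 with ht | ht
    · rw [hS0 _ hNv t ht, hS0 _ hNw t ht, sub_self, norm_zero]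
      have := hWpos t
      positivity
    · have h1 := ((hS _ hNv).sub (hS _ hNw)).energy (hNv.sub hNw) ((hSc _ hNv).sub (hSc _ hNw)) ht
      rw [hS0 _ hNv 0 le_rfl, hS0 _ hNw 0 le_rfl, sub_self, norm_zero] at h1
      have h2 : ∫ s in (0 : ℝ)..t, ‖N s (v s) - N s (w s)‖ ^ 2 ≤
          ∫ s in (0 : ℝ)..t, d ^ 2 * (L s ^ 2 * W s ^ 2) := by
        refine intervalIntegral.integral_mono_on ht
          (((hNv.sub hNw).norm.pow 2).intervalIntegrable _ _)
          ((((hL.pow 2).mul (hWc.pow 2)).const_mul _).intervalIntegrable _ _) fun s hs => ?_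
        have h3 : ‖N s (v s) - N s (w s)‖ ≤ L s * (d * W s) :=
          (hLip s hs.1 _ _).trans (mul_le_mul_of_nonneg_left (hvw s) (hL0 s))
        calc ‖N s (v s) - N s (w s)‖ ^ 2 ≤ (L s * (d * W s)) ^ 2 :=
              pow_le_pow_left₀ (norm_nonneg _) h3 2
          _ = d ^ 2 * (L s ^ 2 * W s ^ 2) := by ring
      rw [intervalIntegral.integral_const_mul] at h2
      have h4 := mul_le_mul_of_nonneg_left (integral_picardWeight_le hL hmono hL0 ht) (sq_nonneg d)
      have h5 : 0 ≤ d / 2 * W t := by have := hWpos t; positivity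
      refine abs_le_of_sq_le_sq' ?_ h5 |>.2
      calc _ ≤ d ^ 2 * (W t ^ 2 / 4) := by linarith
        _ = (d / 2 * W t) ^ 2 := by ring
  -- the Picard map on weighted bounded functions
  have hbase : ∀ t, ‖S (fun _ => 0) t‖ ≤ ‖u₀‖ := by
    intro t
    rcases le_total t 0 with ht | ht
    · rw [hS0 _ continuous_const t ht]
    · have hz : Continuous fun _ : ℝ => (0 : Seq) := continuous_const
      have h1 := (hS _ hz).energy hz (hSc _ hz) ht
      rw [hS0 _ hz 0 le_rfl] at h1
      simp only [norm_zero, ne_eq, OfNat.ofNat_ne_zero, not_false_eq_true, zero_pow,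
        intervalIntegral.integral_zero, add_zero] at h1
      exact abs_le_of_sq_le_sq' h1 (norm_nonneg _) |>.2
  have hcont : ∀ f : BoundedContinuousFunction ℝ Seq, Continuous fun t => W t • f t :=
    fun f => hWc.smul f.continuous
  have hNc : ∀ f : BoundedContinuousFunction ℝ Seq, Continuous fun t => N t (W t • f t) :=
    fun f => hN.comp (continuous_id.prodMk (hcont f))
  -- The unknown is f = v / W, so the weighted norm of v is the ordinary sup norm of f and
  -- completeness comes for free.
  let Φ : BoundedContinuousFunction ℝ Seq → BoundedContinuousFunction ℝ Seq := fun f =>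
    BoundedContinuousFunction.ofNormedAddCommGroup
      (fun t => (W t)⁻¹ • S (fun t => N t (W t • f t)) t)
      ((hWc.inv₀ fun t => (hWpos t).ne').smul (hSc _ (hNc f))) (‖f‖ / 2 + ‖u₀‖) (by
        intro t
        have h1 := hdiff (fun t => W t • f t) (fun _ => 0) (hcont f) continuous_const ‖f‖
          (norm_nonneg _) (fun s => by
            rw [sub_zero, norm_smul, Real.norm_of_nonneg (hWpos s).le, mul_comm]
            exact mul_le_mul_of_nonneg_right (f.norm_coe_le_norm s) (hWpos s).le) t
        simp only [hN0] at h1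
        have h2 : ‖S (fun t => N t (W t • f t)) t‖ ≤ ‖f‖ / 2 * W t + ‖u₀‖ := by
          linarith [hbase t, norm_sub_norm_le (S (fun t => N t (W t • f t)) t) (S (fun _ => 0) t)]
        rw [norm_smul, norm_inv, Real.norm_of_nonneg (hWpos t).le, inv_mul_le_iff₀ (hWpos t)]
        nlinarith [one_le_picardWeight L t, norm_nonneg u₀])
  have hΦ : ContractingWith (1 / 2) Φ := by
    refine ⟨by rw [← NNReal.coe_lt_coe]; norm_num, LipschitzWith.of_dist_le_mul fun f g => ?_⟩
    rw [BoundedContinuousFunction.dist_le (by positivity)]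
    intro t
    have h1 := hdiff (fun t => W t • f t) (fun t => W t • g t) (hcont f) (hcont g) (dist f g)
      dist_nonneg (fun s => by
        rw [← smul_sub, norm_smul, Real.norm_of_nonneg (hWpos s).le, mul_comm, ← dist_eq_norm]
        exact mul_le_mul_of_nonneg_right (BoundedContinuousFunction.dist_coe_le_dist s)
          (hWpos s).le) t
    change dist ((W t)⁻¹ • S (fun t => N t (W t • f t)) t)
      ((W t)⁻¹ • S (fun t => N t (W t • g t)) t) ≤ _
    rw [dist_eq_norm, ← smul_sub, norm_smul, norm_inv, Real.norm_of_nonneg (hWpos t).le,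
      inv_mul_le_iff₀ (hWpos t)]
    refine h1.trans (le_of_eq ?_)
    push_cast
    ring
  set f := hΦ.fixedPoint Φ with hf
  have hfix : Φ f = f := hΦ.fixedPoint_isFixedPt
  have hfS : (fun t => W t • f t) = S (fun t => N t (W t • f t)) := by
    funext t
    have h1 : f t = (W t)⁻¹ • S (fun t => N t (W t • f t)) t := by
      conv_lhs => rw [← hfix]
      rfl
    change W t • f t = _
    conv_lhs => rw [h1, smul_inv_smul₀ (hWpos t).ne']
  refine ⟨fun t => W t • f t, hcont f, ?_, ?_⟩
  · rw [hfS]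
    exact hS0 _ (hNc f) 0 le_rfl
  · have h1 := hS _ (hNc f)
    rwa [← hfS] at h1

/-! ### Flows with a quadratic nonlinearity: a priori bounds. -/

/-- Division of the `n`-th entry by `n + 1`. -/
noncomputable def divFreq : Seq →L[ℝ] Seq :=
  LinearMap.mkContinuous
    { toFun := fun x => Seq.mk (fun n => x n / freq n) <|
        Summable.of_nonneg_of_le (fun _ => sq_nonneg _)
          (fun n => by
            rw [div_pow]
            exact div_le_self (sq_nonneg _) (one_le_pow₀ (one_le_freq n)))
          x.hasSum_sq.summable
      map_add' := fun x y => by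
        ext n
        simp only [Seq.mk_apply, Seq.add_apply, add_div]
      map_smul' := fun c x => by
        ext n
        simp only [Seq.mk_apply, Seq.smul_apply, mul_div_assoc, RingHom.id_apply] }
    1 fun x => by
      rw [one_mul]
      refine abs_le_of_sq_le_sq' ?_ (norm_nonneg _) |>.2
      rw [← x.hasSum_sq.tsum_eq]
      refine Seq.norm_sq_le_of_sq_le x.hasSum_sq.summable fun n => ?_
      change (x n / freq n) ^ 2 ≤ x n ^ 2
      rw [div_pow]
      exact div_le_self (sq_nonneg _) (one_le_pow₀ (one_le_freq n))

@[simp] theorem divFreq_apply (x : Seq) (n : ℕ) : divFreq x n = x n / freq n := rfl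

theorem norm_bilin_sub_le (B : Seq →L[ℝ] Seq →L[ℝ] Seq) (a b : Seq) :
    ‖B a a - B b b‖ ≤ ‖B‖ * (‖a‖ + ‖b‖) * ‖a - b‖ := by
  have h : B a a - B b b = B a (a - b) + B (a - b) b := by
    simp only [map_sub, sub_apply]
    abel
  rw [h]
  calc ‖B a (a - b) + B (a - b) b‖ ≤ ‖B a (a - b)‖ + ‖B (a - b) b‖ := norm_add_le _ _
    _ ≤ ‖B‖ * ‖a‖ * ‖a - b‖ + ‖B‖ * ‖a - b‖ * ‖b‖ :=
      add_le_add (B.le_opNorm₂ _ _) (B.le_opNorm₂ _ _)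
    _ = _ := by ring

/-- `v` solves `vₙ' = -(n+1)² vₙ + (n+1) c(t) B(v, v)ₙ` for positive times. -/
structure IsFlow (B : Seq →L[ℝ] Seq →L[ℝ] Seq) (c : ℝ → ℝ) (v : ℝ → Seq) : Prop where
  cont : Continuous v
  solves : SolvesHeat (fun t => c t • B (v t) (v t)) v

theorem continuous_bilin (B : Seq →L[ℝ] Seq →L[ℝ] Seq) {c : ℝ → ℝ} {v : ℝ → Seq}
    (hc : Continuous c) (hv : Continuous v) : Continuous fun t => c t • B (v t) (v t) := by
  fun_prop

/-- The energy law in the weaker norm, in which the nonlinearity does no work. -/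
theorem IsFlow.integral_norm_sq_le {B : Seq →L[ℝ] Seq →L[ℝ] Seq}
    (hB : ∀ x, inner ℝ (divFreq x) (B x x) = 0) {c : ℝ → ℝ} {v : ℝ → Seq} (h : IsFlow B c v)
    (hc : Continuous c) {T : ℝ} (hT : 0 ≤ T) :
    2 * ∫ t in (0 : ℝ)..T, ‖v t‖ ^ 2 ≤ ‖v 0‖ ^ 2 := by
  have hv := h.cont
  have hvn : ∀ n, Continuous fun t => v t n := fun n => (Seq.continuous_apply n).comp hv
  have hBc : Continuous fun t => B (v t) (v t) := by fun_prop
  have hBn : ∀ n, Continuous fun t => B (v t) (v t) n := fun n =>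
    (Seq.continuous_apply n).comp hBc
  -- The derivative of (vₙ/(n+1))², where the division cancels the unbounded factors. Its sum over n
  -- is -2‖v‖², since the nonlinear parts add up to the vanishing inner product.
  set F : ℕ → ℝ → ℝ := fun n t =>
    -2 * v t n ^ 2 + 2 * c t * (divFreq (v t) n * B (v t) (v t) n) with hF
  have hFc : ∀ n, Continuous (F n) := fun n => by
    have h1 := hvn n
    have h2 := hBn n
    have h3 : Continuous fun t => divFreq (v t) n := (hvn n).div_const _
    exact (continuous_const.mul (h1.pow 2)).add ((continuous_const.mul hc).mul (h3.mul h2))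
  have hFsum : ∀ t, HasSum (fun n => F n t) (-2 * ‖v t‖ ^ 2) := fun t => by
    have h1 := (v t).hasSum_sq.mul_left (-2)
    have h2 := (lp.hasSum_inner (𝕜 := ℝ) (divFreq (v t)) (B (v t) (v t))).mul_left (2 * c t)
    rw [hB, mul_zero] at h2
    have h3 := h1.add h2
    rw [add_zero] at h3
    refine h3.congr_fun ?_ |> fun h => h
    intro n
    simp only [hF, RCLike.inner_apply, conj_trivial]
    ring
  -- A summable majorant with a continuous sum, which justifies exchanging the sum with the time
  -- integral.
  set b : ℕ → ℝ → ℝ := fun n t => (2 + |c t|) * v t n ^ 2 + |c t| * B (v t) (v t) n ^ 2 with hb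
  have hbsum : ∀ t, HasSum (fun n => b n t)
      ((2 + |c t|) * ‖v t‖ ^ 2 + |c t| * ‖B (v t) (v t)‖ ^ 2) := fun t =>
    ((v t).hasSum_sq.mul_left _).add ((Seq.hasSum_sq _).mul_left _)
  have hFb : ∀ n t, ‖F n t‖ ≤ b n t := fun n t => by
    have h1 : |divFreq (v t) n| ≤ |v t n| := by
      rw [divFreq_apply, abs_div, abs_of_pos (freq_pos n)]
      exact div_le_self (abs_nonneg _) (one_le_freq n)
    have h2 : |divFreq (v t) n * B (v t) (v t) n| ≤ |v t n| * |B (v t) (v t) n| := by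
      rw [abs_mul]; exact mul_le_mul_of_nonneg_right h1 (abs_nonneg _)
    have h3 : 2 * (|v t n| * |B (v t) (v t) n|) ≤ v t n ^ 2 + B (v t) (v t) n ^ 2 := by
      nlinarith [sq_nonneg (|v t n| - |B (v t) (v t) n|), sq_abs (v t n),
        sq_abs (B (v t) (v t) n)]
    calc ‖F n t‖ ≤ |-2 * v t n ^ 2| + |2 * c t * (divFreq (v t) n * B (v t) (v t) n)| :=
          abs_add_le _ _
      _ = 2 * v t n ^ 2 + 2 * |c t| * |divFreq (v t) n * B (v t) (v t) n| := by
          rw [abs_mul, abs_mul (2 * c t), abs_mul 2, abs_of_nonneg (sq_nonneg (v t n))]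
          norm_num
      _ ≤ 2 * v t n ^ 2 + |c t| * (v t n ^ 2 + B (v t) (v t) n ^ 2) := by
          nlinarith [abs_nonneg (c t)]
      _ = b n t := by simp only [hb]; ring
  have hint := intervalIntegral.hasSum_integral_of_dominated_convergence (μ := volume)
    (a := (0 : ℝ)) (b := T) (F := F) (f := fun t => -2 * ‖v t‖ ^ 2) b
    (fun n => (hFc n).aestronglyMeasurable)
    (fun n => Eventually.of_forall fun t _ => hFb n t)
    (Eventually.of_forall fun t _ => (hbsum t).summable)
    (by
      simp only [fun t => (hbsum t).tsum_eq]
      have : Continuous fun t => (2 + |c t|) * ‖v t‖ ^ 2 + |c t| * ‖B (v t) (v t)‖ ^ 2 := by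
        fun_prop
      exact this.intervalIntegrable _ _)
    (Eventually.of_forall fun t _ => hFsum t)
  -- The square at the final time is dropped, and the initial one is enlarged using n + 1 ≥ 1.
  have hlow : ∀ n, -(v 0 n ^ 2) ≤ ∫ t in (0 : ℝ)..T, F n t := fun n => by
    have hd : ∀ t ∈ Set.Ioo 0 T, HasDerivAt (fun t => (v t n / freq n) ^ 2) (F n t) t := by
      intro t ht
      refine (((h.solves t ht.1 n).div_const (freq n)).fun_pow 2).congr_deriv ?_
      have key : ∀ k x r y : ℝ, k ≠ 0 → (2 : ℕ) * (x / k) ^ (2 - 1) *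
          ((-k ^ 2 * x + k * (r * y)) / k) = -2 * x ^ 2 + 2 * r * (x / k * y) := by
        intro k x r y hk
        rw [show 2 - 1 = 1 from rfl, pow_one, Nat.cast_ofNat]
        field_simp
      exact key _ _ _ _ (freq_ne_zero n)
    rw [intervalIntegral.integral_eq_sub_of_hasDerivAt_of_le hT
      (f := fun t => (v t n / freq n) ^ 2) (((hvn n).div_const _).pow 2).continuousOn hd ((hFc n).intervalIntegrable _ _)]
    have h1 : (v 0 n / freq n) ^ 2 ≤ v 0 n ^ 2 := by
      rw [div_pow]
      exact div_le_self (sq_nonneg _) (one_le_pow₀ (one_le_freq n))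
    linarith [sq_nonneg (v T n / freq n)]
  have h2 := hasSum_le hlow (v 0).hasSum_sq.neg hint
  rw [intervalIntegral.integral_const_mul] at h2
  linarith

/-- The a priori bound that rules out blow-up. -/
theorem IsFlow.norm_sq_le {B : Seq →L[ℝ] Seq →L[ℝ] Seq}
    (hB : ∀ x, inner ℝ (divFreq x) (B x x) = 0) {c : ℝ → ℝ} {v : ℝ → Seq} (h : IsFlow B c v)
    (hc : Continuous c) {T γ : ℝ} (hT : 0 ≤ T) (hγ : ∀ t ∈ Set.Icc 0 T, |c t| ≤ γ) :
    ‖v T‖ ^ 2 ≤ ‖v 0‖ ^ 2 * Real.exp (‖B‖ ^ 2 * γ ^ 2 * ‖v 0‖ ^ 2 / 2) := by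
  have hv := h.cont
  have hg := continuous_bilin B hc hv
  -- The quartic term ‖v‖⁴ is read as the rate ‖B‖²γ²‖v‖² times ‖v‖². The integral of this rate is
  -- bounded by the weaker energy law, which produces the 1/2 in the exponent.
  have h1 := le_mul_exp_of_le_add_integral (y := fun t => ‖v t‖ ^ 2)
    (q := fun t => ‖B‖ ^ 2 * γ ^ 2 * ‖v t‖ ^ 2) (C := ‖v 0‖ ^ 2) (by fun_prop) (by fun_prop)
    (fun t => by positivity) hT (fun t ht => by
      refine (h.solves.energy hg hv ht.1).trans (add_le_add_right ?_ _)
      refine intervalIntegral.integral_mono_on ht.1 ((hg.norm.pow 2).intervalIntegrable _ _)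
        (Continuous.intervalIntegrable (by fun_prop) _ _) fun s hs => ?_
      have h2 : |c s| ≤ γ := hγ s ⟨hs.1, hs.2.trans ht.2⟩
      have h3 : ‖c s • B (v s) (v s)‖ ≤ γ * (‖B‖ * ‖v s‖ * ‖v s‖) := by
        rw [norm_smul]
        exact mul_le_mul h2 (B.le_opNorm₂ _ _) (norm_nonneg _) ((abs_nonneg _).trans h2)
      calc ‖c s • B (v s) (v s)‖ ^ 2 ≤ (γ * (‖B‖ * ‖v s‖ * ‖v s‖)) ^ 2 :=
            pow_le_pow_left₀ (norm_nonneg _) h3 2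
        _ = _ := by ring)
  refine h1.trans (mul_le_mul_of_nonneg_left (Real.exp_le_exp.2 ?_) (sq_nonneg _))
  rw [intervalIntegral.integral_const_mul]
  have h2 := h.integral_norm_sq_le hB hc hT
  have h3 : 0 ≤ ‖B‖ ^ 2 * γ ^ 2 := by positivity
  nlinarith

/-! ### Truncation and global existence. -/

/-- Radial retraction onto the ball of radius `R`. -/
noncomputable def trunc (R : ℝ) (x : Seq) : Seq := (R / max R ‖x‖) • x

theorem norm_trunc_le {R : ℝ} (hR : 0 < R) (x : Seq) : ‖trunc R x‖ ≤ R := by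
  have h : 0 < max R ‖x‖ := lt_max_of_lt_left hR
  rw [trunc, norm_smul, Real.norm_of_nonneg (by positivity), div_mul_eq_mul_div, div_le_iff₀ h]
  exact mul_le_mul_of_nonneg_left (le_max_right _ _) hR.le

theorem trunc_eq_self {R : ℝ} (hR : 0 < R) {x : Seq} (hx : ‖x‖ ≤ R) : trunc R x = x := by
  rw [trunc, max_eq_left hx, div_self hR.ne', one_smul]

/-- The moving point and the moving scaling factor contribute ‖x - y‖ each. Any Lipschitz constant
independent of R would serve. -/
theorem norm_trunc_sub_le {R : ℝ} (hR : 0 < R) (x y : Seq) :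
    ‖trunc R x - trunc R y‖ ≤ 2 * ‖x - y‖ := by
  have hp : 0 < max R ‖x‖ := lt_max_of_lt_left hR
  have hq : 0 < max R ‖y‖ := lt_max_of_lt_left hR
  have h1 : trunc R x - trunc R y =
      (R / max R ‖x‖) • (x - y) + (R / max R ‖x‖ - R / max R ‖y‖) • y := by
    simp only [trunc, smul_sub, sub_smul]
    abel
  have hd : |max R ‖y‖ - max R ‖x‖| ≤ ‖x - y‖ := by
    have h2 := abs_max_sub_max_le_max R ‖y‖ R ‖x‖
    rw [sub_self, abs_zero, max_eq_right (abs_nonneg (‖y‖ - ‖x‖))] at h2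
    exact h2.trans (by rw [norm_sub_rev]; exact abs_norm_sub_norm_le y x)
  have h3 : ‖(R / max R ‖x‖) • (x - y)‖ ≤ ‖x - y‖ := by
    rw [norm_smul, Real.norm_of_nonneg (by positivity)]
    exact mul_le_of_le_one_left (norm_nonneg _) ((div_le_one hp).2 (le_max_left _ _))
  have h4 : ‖(R / max R ‖x‖ - R / max R ‖y‖) • y‖ ≤ ‖x - y‖ := by
    have h5 : R / max R ‖x‖ - R / max R ‖y‖ =
        R / max R ‖x‖ * ((max R ‖y‖ - max R ‖x‖) / max R ‖y‖) := by
      field_simp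
    rw [norm_smul, h5, Real.norm_eq_abs, abs_mul, abs_div, abs_div, abs_of_pos hp, abs_of_pos hq,
      abs_of_pos hR]
    have h6 : R / max R ‖x‖ ≤ 1 := (div_le_one hp).2 (le_max_left _ _)
    have h7 : ‖y‖ / max R ‖y‖ ≤ 1 := (div_le_one hq).2 (le_max_right _ _)
    calc R / max R ‖x‖ * (|max R ‖y‖ - max R ‖x‖| / max R ‖y‖) * ‖y‖
        = R / max R ‖x‖ * (|max R ‖y‖ - max R ‖x‖| * (‖y‖ / max R ‖y‖)) := by ring
      _ ≤ 1 * (‖x - y‖ * 1) := by gcongr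
      _ = ‖x - y‖ := by ring
  rw [h1]
  linarith [norm_add_le ((R / max R ‖x‖) • (x - y)) ((R / max R ‖x‖ - R / max R ‖y‖) • y)]

theorem exists_isFlow {B : Seq →L[ℝ] Seq →L[ℝ] Seq}
    (hB : ∀ x, inner ℝ (divFreq x) (B x x) = 0) {c : ℝ → ℝ} (hc : Continuous c)
    (hmono : Monotone c) (h0 : ∀ t, 0 ≤ c t) (v₀ : Seq) :
    ∃ v, IsFlow B c v ∧ v 0 = v₀ := by
  -- The square root of the a priori bound turns 1/2 into 1/4. The summand 1 makes R positive even
  -- for zero initial value.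
  set R : ℝ → ℝ := fun t => 1 + ‖v₀‖ * Real.exp (‖B‖ ^ 2 * c t ^ 2 * ‖v₀‖ ^ 2 / 4) with hR
  have hR1 : ∀ t, 0 < R t := fun t => by positivity
  have hRc : Continuous R := by fun_prop
  have hRm : Monotone R := fun s t hst => by
    have h1 : c s ^ 2 ≤ c t ^ 2 := pow_le_pow_left₀ (h0 s) (hmono hst) 2
    simp only [hR]
    gcongr
  have htc : Continuous fun p : ℝ × Seq => trunc (R p.1) p.2 := by
    have h1 : ∀ p : ℝ × Seq, max (R p.1) ‖p.2‖ ≠ 0 := fun p =>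
      (lt_max_of_lt_left (hR1 _)).ne'
    have h2 : Continuous fun p : ℝ × Seq => R p.1 := hRc.comp continuous_fst
    exact (h2.div (h2.max continuous_snd.norm) h1).smul continuous_snd
  obtain ⟨v, hv, hv0, hs⟩ := exists_solvesHeat_of_lipschitz
    (N := fun t x => c t • B (trunc (R t) x) (trunc (R t) x))
    (L := fun t => 4 * (c t * ‖B‖ * R t))
    (by
      have h1 : Continuous fun p : ℝ × Seq => c p.1 := hc.comp continuous_fst
      fun_prop)
    (fun t => by simp [trunc]) (by fun_prop)
    (fun s t hst => by
      have h1 := hmono hst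
      have h2 := hRm hst
      have h3 := h0 t
      have h4 := (hR1 s).le
      dsimp only
      gcongr)
    (fun t => by
      have h3 := h0 t
      have h4 := hR1 t
      positivity)
    (fun t _ x y => by
      rw [← smul_sub, norm_smul, Real.norm_of_nonneg (h0 t)]
      have h1 := norm_bilin_sub_le B (trunc (R t) x) (trunc (R t) y)
      have h2 : ‖B‖ * (‖trunc (R t) x‖ + ‖trunc (R t) y‖) * ‖trunc (R t) x - trunc (R t) y‖ ≤
          ‖B‖ * (R t + R t) * (2 * ‖x - y‖) := by
        have := (hR1 t).le
        gcongr
        · exact norm_trunc_le (hR1 t) x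
        · exact norm_trunc_le (hR1 t) y
        · exact norm_trunc_sub_le (hR1 t) x y
      calc c t * _ ≤ c t * (‖B‖ * (R t + R t) * (2 * ‖x - y‖)) :=
            mul_le_mul_of_nonneg_left (h1.trans h2) (h0 t)
        _ = _ := by ring) v₀
  set θ : ℝ → ℝ := fun t => R t / max (R t) ‖v t‖ with hθ
  have hmax : ∀ t, 0 < max (R t) ‖v t‖ := fun t => lt_max_of_lt_left (hR1 t)
  have hθc : Continuous θ := hRc.div (hRc.max hv.norm) fun t => (hmax t).ne'
  have hθ0 : ∀ t, 0 ≤ θ t := fun t => div_nonneg (hR1 t).le (hmax t).le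
  have hθ1 : ∀ t, θ t ≤ 1 := fun t => (div_le_one (hmax t)).2 (le_max_left _ _)
  -- Truncation is scaling by θ and B is bilinear, so the truncated solution is a genuine flow with
  -- the smaller coefficient cθ² ≤ c. The a priori bound applies to it and keeps it inside the ball
  -- where nothing is truncated.
  have hd : IsFlow B (fun t => c t * θ t ^ 2) v := ⟨hv, fun t ht n => by
    refine (hs t ht n).congr_deriv ?_
    simp only [trunc, map_smul, smul_apply, smul_smul, hθ]
    ring_nf⟩
  have hbd : ∀ t, 0 ≤ t → ‖v t‖ ≤ R t := fun t ht => by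
    have h1 := hd.norm_sq_le hB (hc.mul (hθc.pow 2)) ht (γ := c t) fun s hs => by
      rw [abs_of_nonneg (mul_nonneg (h0 s) (sq_nonneg _))]
      calc c s * θ s ^ 2 ≤ c s * 1 :=
            mul_le_mul_of_nonneg_left (pow_le_one₀ (hθ0 s) (hθ1 s)) (h0 s)
        _ ≤ c t := by rw [mul_one]; exact hmono hs.2
    rw [hv0] at h1
    have h2 : ‖v t‖ ^ 2 ≤ (‖v₀‖ * Real.exp (‖B‖ ^ 2 * c t ^ 2 * ‖v₀‖ ^ 2 / 4)) ^ 2 := by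
      rw [mul_pow, ← Real.exp_nat_mul]
      refine h1.trans (le_of_eq ?_)
      congr 2
      push_cast
      ring
    have h3 := abs_le_of_sq_le_sq' h2 (by positivity) |>.2
    simp only [hR]
    linarith
  refine ⟨v, ⟨hv, fun t ht n => ?_⟩, hv0⟩
  have h1 := hs t ht n
  dsimp only at h1
  rwa [trunc_eq_self (hR1 t) (hbd t ht.le)] at h1

/-! ### Continuous dependence and uniqueness of flows. -/

/-- Continuous dependence on the initial value and on the coefficient. -/
theorem IsFlow.norm_sub_sq_le {B : Seq →L[ℝ] Seq →L[ℝ] Seq} {c c' : ℝ → ℝ} {v v' : ℝ → Seq}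
    (h : IsFlow B c v) (h' : IsFlow B c' v') (hc : Continuous c) (hc' : Continuous c')
    {T γ η M : ℝ} (hT : 0 ≤ T) (hγ : ∀ t ∈ Set.Icc 0 T, |c t| ≤ γ)
    (hη : ∀ t ∈ Set.Icc 0 T, |c t - c' t| ≤ η) (hM : ∀ t ∈ Set.Icc 0 T, ‖v t‖ ≤ M)
    (hM' : ∀ t ∈ Set.Icc 0 T, ‖v' t‖ ≤ M) :
    ‖v T - v' T‖ ^ 2 ≤ (‖v 0 - v' 0‖ ^ 2 + T * (2 * η ^ 2 * ‖B‖ ^ 2 * M ^ 4)) *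
      Real.exp (T * (8 * γ ^ 2 * ‖B‖ ^ 2 * M ^ 2)) := by
  have hv := h.cont
  have hv' := h'.cont
  have hg := continuous_bilin B hc hv
  have hg' := continuous_bilin B hc' hv'
  have h1 := le_mul_exp_of_le_add_integral (y := fun t => ‖v t - v' t‖ ^ 2)
    (q := fun _ => 8 * γ ^ 2 * ‖B‖ ^ 2 * M ^ 2)
    (C := ‖v 0 - v' 0‖ ^ 2 + T * (2 * η ^ 2 * ‖B‖ ^ 2 * M ^ 4)) (by fun_prop) (by fun_prop)
    (fun t => by positivity) hT (fun t ht => by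
      refine ((h.solves.sub h'.solves).energy (hg.sub hg') (hv.sub hv') ht.1).trans ?_
      have h2 : ∫ s in (0 : ℝ)..t, ‖c s • B (v s) (v s) - c' s • B (v' s) (v' s)‖ ^ 2 ≤
          ∫ s in (0 : ℝ)..t, (2 * η ^ 2 * ‖B‖ ^ 2 * M ^ 4 +
            8 * γ ^ 2 * ‖B‖ ^ 2 * M ^ 2 * ‖v s - v' s‖ ^ 2) := by
        refine intervalIntegral.integral_mono_on ht.1
          (((hg.sub hg').norm.pow 2).intervalIntegrable _ _)
          (Continuous.intervalIntegrable (by fun_prop) _ _) fun s hs => ?_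
        have hs' : s ∈ Set.Icc 0 T := ⟨hs.1, hs.2.trans ht.2⟩
        have hM0 : 0 ≤ M := (norm_nonneg _).trans (hM s hs')
        have hγ0 : 0 ≤ γ := (abs_nonneg _).trans (hγ s hs')
        have hη0 : 0 ≤ η := (abs_nonneg _).trans (hη s hs')
        -- The difference is split into a change of state and a change of coefficient; (p + q)² ≤
        -- 2p² + 2q² then gives the constants 8 and 2.
        have h3 : c s • B (v s) (v s) - c' s • B (v' s) (v' s) =
            c s • (B (v s) (v s) - B (v' s) (v' s)) + (c s - c' s) • B (v' s) (v' s) := by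
          simp only [smul_sub, sub_smul]
          abel
        have h4 : ‖c s • (B (v s) (v s) - B (v' s) (v' s))‖ ≤
            γ * (‖B‖ * (M + M) * ‖v s - v' s‖) := by
          rw [norm_smul]
          refine mul_le_mul (hγ s hs') ((norm_bilin_sub_le B _ _).trans ?_) (norm_nonneg _) hγ0
          have := hM s hs'
          have := hM' s hs'
          gcongr
        have h5 : ‖(c s - c' s) • B (v' s) (v' s)‖ ≤ η * (‖B‖ * M * M) := by
          rw [norm_smul]
          refine mul_le_mul (hη s hs') ((B.le_opNorm₂ _ _).trans ?_) (norm_nonneg _) hη0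
          have := hM' s hs'
          gcongr
        have h6 : ‖c s • B (v s) (v s) - c' s • B (v' s) (v' s)‖ ≤
            γ * (‖B‖ * (M + M) * ‖v s - v' s‖) + η * (‖B‖ * M * M) := by
          rw [h3]
          exact (norm_add_le _ _).trans (add_le_add h4 h5)
        calc _ ≤ (γ * (‖B‖ * (M + M) * ‖v s - v' s‖) + η * (‖B‖ * M * M)) ^ 2 :=
              pow_le_pow_left₀ (norm_nonneg _) h6 2
          _ ≤ 2 * ((γ * (‖B‖ * (M + M) * ‖v s - v' s‖)) ^ 2 + (η * (‖B‖ * M * M)) ^ 2) :=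
              add_sq_le
          _ = _ := by ring
      rw [intervalIntegral.integral_add (by simp)
        (Continuous.intervalIntegrable (by fun_prop) _ _), intervalIntegral.integral_const] at h2
      have h3 : t * (2 * η ^ 2 * ‖B‖ ^ 2 * M ^ 4) ≤ T * (2 * η ^ 2 * ‖B‖ ^ 2 * M ^ 4) :=
        mul_le_mul_of_nonneg_right ht.2 (by positivity)
      simp only [sub_zero, smul_eq_mul] at h2
      linarith)
  rwa [intervalIntegral.integral_const, sub_zero, smul_eq_mul] at h1

theorem IsFlow.eq_of_eq_zero {B : Seq →L[ℝ] Seq →L[ℝ] Seq} {c : ℝ → ℝ} {v v' : ℝ → Seq}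
    (h : IsFlow B c v) (h' : IsFlow B c v') (hc : Continuous c) (h0 : v 0 = v' 0)
    {T : ℝ} (hT : 0 ≤ T) : v T = v' T := by
  have hbd : ∀ f : ℝ → ℝ, Continuous f → ∃ C, ∀ t ∈ Set.Icc 0 T, f t ≤ C := fun f hf => by
    obtain ⟨C, hC⟩ := (isCompact_Icc (a := (0 : ℝ)) (b := T)).bddAbove_image hf.continuousOn
    exact ⟨C, fun t ht => hC ⟨t, ht, rfl⟩⟩
  obtain ⟨M, hM⟩ := hbd _ h.cont.norm
  obtain ⟨M', hM'⟩ := hbd _ h'.cont.norm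
  obtain ⟨γ, hγ⟩ := hbd _ hc.abs
  have h1 := h.norm_sub_sq_le h' hc hc hT (η := 0) (M := max M M') hγ (by simp)
    (fun t ht => (hM t ht).trans (le_max_left _ _))
    (fun t ht => (hM' t ht).trans (le_max_right _ _))
  rw [h0] at h1
  simp only [sub_self, norm_zero, ne_eq, OfNat.ofNat_ne_zero, not_false_eq_true, zero_pow,
    mul_zero, zero_mul, add_zero] at h1
  exact sub_eq_zero.1 (norm_eq_zero.1 (pow_eq_zero_iff (two_ne_zero) |>.1
    (le_antisymm h1 (sq_nonneg _))))

/-! ### Parabolic smoothing and differentiability in time. -/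

theorem Seq.tsum_ofReal_sq (x : Seq) :
    ∑' n, ENNReal.ofReal (x n ^ 2) = ENNReal.ofReal (‖x‖ ^ 2) := by
  rw [← x.hasSum_sq.tsum_eq, ENNReal.ofReal_tsum_of_nonneg (fun _ => sq_nonneg _)
    x.hasSum_sq.summable]

theorem summable_of_tsum_ofReal_ne_top {f : ℕ → ℝ} (h0 : ∀ n, 0 ≤ f n)
    (h : ∑' n, ENNReal.ofReal (f n) ≠ ⊤) : Summable f := by
  have h1 := ENNReal.summable_toReal h
  simpa only [ENNReal.toReal_ofReal (h0 _)] using h1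

theorem lintegral_tsum_ofReal {T : ℝ} (hT : 0 ≤ T) {f : ℕ → ℝ → ℝ} (hc : ∀ n, Continuous (f n))
    (h0 : ∀ n t, 0 ≤ f n t) :
    ∫⁻ t in Set.Ioc 0 T, ∑' n, ENNReal.ofReal (f n t) =
      ∑' n, ENNReal.ofReal (∫ t in (0 : ℝ)..T, f n t) := by
  rw [lintegral_tsum fun n => (hc n).measurable.ennreal_ofReal.aemeasurable]
  congr 1
  funext n
  rw [intervalIntegral.integral_of_le hT, ofReal_integral_eq_lintegral_ofReal
    ((hc n).integrableOn_Ioc) (Eventually.of_forall (h0 n))]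

/-- A nonlinearity that maps sequences with square-summable `(n+1) xₙ` to such sequences. -/
def PreservesRegularity (B : Seq →L[ℝ] Seq →L[ℝ] Seq) : Prop :=
  ∃ K : ℝ, ∀ V : Seq, ∃ W : Seq, (∀ n, W n = freq n * B (divFreq V) (divFreq V) n) ∧
    ‖W‖ ≤ K * ‖V‖ * ‖divFreq V‖

/-- Parabolic smoothing: for positive times a flow gains one derivative. -/
theorem IsFlow.exists_regular {B : Seq →L[ℝ] Seq →L[ℝ] Seq} (hB : PreservesRegularity B)
    {c : ℝ → ℝ} {v : ℝ → Seq} (h : IsFlow B c v) (hc : Continuous c) :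
    ∃ V : ℝ → Seq, ContinuousOn V (Set.Ioi 0) ∧ ∀ t, 0 < t → divFreq (V t) = v t := by
  obtain ⟨K, hK⟩ := hB
  have hv := h.cont
  have hvn : ∀ n, Continuous fun t => v t n := fun n => (Seq.continuous_apply n).comp hv
  have hBn : ∀ n, Continuous fun t => B (v t) (v t) n := fun n =>
    (Seq.continuous_apply n).comp (by fun_prop)
  set f : ℕ → ℝ → ℝ := fun n t => (freq n * v t n) ^ 2 with hf
  set g : ℕ → ℝ → ℝ := fun n t => (freq n * (c t * B (v t) (v t) n)) ^ 2 with hg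
  have hfc : ∀ n, Continuous (f n) := fun n => (continuous_const.mul (hvn n)).pow 2
  have hgc : ∀ n, Continuous (g n) := fun n =>
    (continuous_const.mul (hc.mul (hBn n))).pow 2
  have hfin : ∀ T, 0 ≤ T → ∫⁻ t in Set.Ioc 0 T, ∑' n, ENNReal.ofReal (f n t) ≠ ⊤ := fun T hT => by
    rw [lintegral_tsum_ofReal hT hfc fun _ _ => sq_nonneg _]
    have h1 := h.solves.summable_dissipation (continuous_bilin B hc hv) hv hT
    have h2 : (fun n => ∫ s in (0 : ℝ)..T, freq n ^ 2 * v s n ^ 2) =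
        fun n => ∫ s in (0 : ℝ)..T, f n s := by
      funext n
      congr 1
      funext s
      simp only [hf, mul_pow]
    rw [h2] at h1
    exact h1.tsum_ofReal_ne_top
  -- The regularity bound on B is linear in the stronger norm, and the weaker norm is bounded on [0,
  -- T]. The differentiated source is therefore dominated by the dissipation, whose time integral is
  -- finite.
  have hgsum : ∀ T, 0 ≤ T → Summable fun n => ∫ t in (0 : ℝ)..T, g n t := fun T hT => by
    obtain ⟨C, hC⟩ := (isCompact_Icc (a := (0 : ℝ)) (b := T)).bddAbove_image
      (f := fun t => |c t| * K * ‖v t‖) (by fun_prop)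
    have hCt : ∀ t ∈ Set.Icc 0 T, |c t| * K * ‖v t‖ ≤ C := fun t ht => hC ⟨t, ht, rfl⟩
    refine summable_of_tsum_ofReal_ne_top
      (fun n => intervalIntegral.integral_nonneg hT fun _ _ => sq_nonneg _) ?_
    rw [← lintegral_tsum_ofReal hT hgc fun _ _ => sq_nonneg _]
    have hle : ∫⁻ t in Set.Ioc 0 T, ∑' n, ENNReal.ofReal (g n t) ≤
        ∫⁻ t in Set.Ioc 0 T, ENNReal.ofReal (C ^ 2 + 1) * ∑' n, ENNReal.ofReal (f n t) := by
      refine setLIntegral_mono' measurableSet_Ioc fun t ht => ?_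
      -- At exceptional times the right side is infinite; the summand 1 in C² + 1 keeps the factor
      -- nonzero there.
      by_cases htop : ∑' n, ENNReal.ofReal (f n t) = ⊤
      · rw [htop, ENNReal.mul_top]
        · exact le_top
        · rw [ne_eq, ENNReal.ofReal_eq_zero]
          nlinarith [sq_nonneg C]
      · have hs : Summable fun n => f n t := summable_of_tsum_ofReal_ne_top
          (fun _ => sq_nonneg _) htop
        set V : Seq := Seq.mk _ hs with hV
        have hDV : divFreq V = v t := by
          ext n
          change freq n * v t n / freq n = v t n
          rw [mul_div_cancel_left₀ _ (freq_ne_zero n)]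
        obtain ⟨W, hW, hWn⟩ := hK V
        rw [hDV] at hW hWn
        have h1 : ∑' n, ENNReal.ofReal (g n t) = ENNReal.ofReal (‖c t • W‖ ^ 2) := by
          rw [← Seq.tsum_ofReal_sq]
          congr 1
          funext n
          rw [Seq.smul_apply, hW]
          simp only [hg]
          ring_nf
        have h2 : ∑' n, ENNReal.ofReal (f n t) = ENNReal.ofReal (‖V‖ ^ 2) := by
          rw [← Seq.tsum_ofReal_sq]
          rfl
        rw [h1, h2, ← ENNReal.ofReal_mul (by positivity)]
        refine ENNReal.ofReal_le_ofReal ?_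
        have h3 : ‖c t • W‖ ≤ C * ‖V‖ := by
          rw [norm_smul, Real.norm_eq_abs]
          calc |c t| * ‖W‖ ≤ |c t| * (K * ‖V‖ * ‖v t‖) :=
                mul_le_mul_of_nonneg_left hWn (abs_nonneg _)
            _ = |c t| * K * ‖v t‖ * ‖V‖ := by ring
            _ ≤ C * ‖V‖ := mul_le_mul_of_nonneg_right (hCt t ⟨ht.1.le, ht.2⟩) (norm_nonneg _)
        have h4 := pow_le_pow_left₀ (norm_nonneg _) h3 2
        nlinarith [sq_nonneg ‖V‖]
    refine ne_top_of_le_ne_top ?_ hle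
    rw [lintegral_const_mul' _ _ ENNReal.ofReal_ne_top]
    exact ENNReal.mul_ne_top ENNReal.ofReal_ne_top (hfin T hT)
  -- A finite time integral is finite at almost every time, so arbitrarily early times have a
  -- regular state from which the differentiated equation can be restarted.
  have hgood : ∀ ε, 0 < ε → ∃ t₀ ∈ Set.Ioc 0 ε, Summable fun n => f n t₀ := fun ε hε => by
    have hmeas : AEMeasurable (fun t => ∑' n, ENNReal.ofReal (f n t))
        (volume.restrict (Set.Ioc 0 ε)) :=
      (Measurable.tsum fun n => (hfc n).measurable.ennreal_ofReal).aemeasurable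
    have h1 := ae_lt_top' hmeas (hfin ε hε.le)
    have h2 : (volume.restrict (Set.Ioc 0 ε)) ≠ 0 := by
      rw [ne_eq, Measure.restrict_eq_zero, Real.volume_Ioc, ENNReal.ofReal_eq_zero]
      linarith
    have : (ae (volume.restrict (Set.Ioc 0 ε))).NeBot := ae_neBot.2 h2
    obtain ⟨t, ht, htI⟩ := (h1.and (ae_restrict_mem measurableSet_Ioc)).exists
    exact ⟨t, htI, summable_of_tsum_ofReal_ne_top (fun _ => sq_nonneg _) ht.ne⟩
  have hdom : ∀ ε T, 0 < ε → ε ≤ T → ∃ a : ℕ → ℝ, Summable a ∧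
      ∀ t ∈ Set.Icc ε T, ∀ n, f n t ≤ a n := fun ε T hε hεT => by
    obtain ⟨t₀, ht₀, hs⟩ := hgood ε hε
    refine ⟨_, hs.add (hgsum T (hε.le.trans hεT)), fun t ht n => ?_⟩
    have h0t : t₀ ≤ t := ht₀.2.trans ht.1
    have h1 := HierCoulomb.mode_energy (κ := freq n) (u := fun t => freq n * v t n)
      (g := fun t => freq n * (c t * B (v t) (v t) n)) h0t
      (continuous_const.mul (hvn n)).continuousOn
      (continuous_const.mul (hc.mul (hBn n))).continuousOn fun s hs => by
        refine ((h.solves s (ht₀.1.trans hs.1) n).const_mul (freq n)).congr_deriv ?_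
        simp only [Seq.smul_apply]
        ring
    have h2 : 0 ≤ ∫ s in t₀..t, freq n ^ 2 * (freq n * v s n) ^ 2 :=
      intervalIntegral.integral_nonneg h0t fun _ _ => by positivity
    have h3 : ∫ s in t₀..t, g n s ≤ ∫ s in (0 : ℝ)..T, g n s :=
      intervalIntegral.integral_mono_interval ht₀.1.le h0t ht.2
        (Eventually.of_forall fun _ => sq_nonneg _) ((hgc n).intervalIntegrable _ _)
    simp only [hf, hg] at h3 ⊢
    linarith
  have hsum : ∀ t, 0 < t → Summable fun n => f n t := fun t ht => by
    obtain ⟨a, ha, hle⟩ := hdom t t ht le_rfl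
    exact Summable.of_nonneg_of_le (fun _ => sq_nonneg _) (hle t ⟨le_rfl, le_rfl⟩) ha
  classical
  set V : ℝ → Seq := fun t => if ht : 0 < t then Seq.mk _ (hsum t ht) else 0 with hV
  have hVn : ∀ t, 0 < t → ∀ n, V t n = freq n * v t n := fun t ht n => by
    simp only [hV, dif_pos ht]
    rfl
  refine ⟨V, ?_, fun t ht => ?_⟩
  · refine continuousOn_of_forall_continuousAt fun t ht => ?_
    have ht0 : 0 < t := ht
    obtain ⟨a, ha, hle⟩ := hdom (t / 2) (t + 1) (by linarith) (by linarith)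
    have h1 : ContinuousOn V (Set.Icc (t / 2) (t + 1)) := by
      refine Seq.continuousOn_of_dominated ha (fun s hs n => ?_) fun n => ?_
      · rw [hVn s (by linarith [hs.1])]
        exact hle s hs n
      · refine ((hvn n).const_mul (freq n)).continuousOn.congr fun s hs => ?_
        exact hVn s (by linarith [hs.1]) n
    exact h1.continuousAt (Icc_mem_nhds (by linarith) (by linarith))
  · ext n
    change V t n / freq n = v t n
    rw [hVn t ht, mul_div_cancel_left₀ _ (freq_ne_zero n)]

/-- A flow is differentiable in the weaker norm. -/
theorem IsFlow.hasDerivAt_divFreq {B : Seq →L[ℝ] Seq →L[ℝ] Seq} {c : ℝ → ℝ} {v V : ℝ → Seq}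
    (h : IsFlow B c v) (hc : Continuous c) (hV : ContinuousOn V (Set.Ioi 0))
    (hVv : ∀ t, 0 < t → divFreq (V t) = v t) {t : ℝ} (ht : 0 < t) :
    HasDerivAt (fun s => divFreq (v s)) (-V t + c t • B (v t) (v t)) t := by
  have hg := continuous_bilin B hc h.cont
  set w : ℝ → Seq := fun s => -V s + c s • B (v s) (v s) with hw
  have hwc : ContinuousOn w (Set.Ioi 0) := hV.neg.add hg.continuousOn
  have ht2 : 0 < t / 2 := by linarith
  have hsub : ∀ s, t / 2 < s → Set.uIcc (t / 2) s ⊆ Set.Ioi 0 := fun s hs r hr => by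
    rw [Set.uIcc_of_le hs.le] at hr
    exact ht2.trans_le hr.1
  have hint : ∀ s, t / 2 < s → IntervalIntegrable w volume (t / 2) s := fun s hs =>
    (hwc.mono (hsub s hs)).intervalIntegrable
  -- The integrated equation is proved entry by entry. It starts at t/2 because V is continuous only
  -- for positive times.
  have heq : ∀ s, t / 2 < s → divFreq (v s) = divFreq (v (t / 2)) + ∫ r in (t / 2)..s, w r := by
    intro s hs
    ext n
    have h1 : (∫ r in (t / 2)..s, w r) n = ∫ r in (t / 2)..s, w r n :=
      ((Seq.eval n).intervalIntegral_comp_comm (hint s hs)).symm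
    have hwn : ContinuousOn (fun r => w r n) (Set.uIcc (t / 2) s) :=
      (Seq.continuous_apply n).comp_continuousOn (hwc.mono (hsub s hs))
    have h2 : ∫ r in (t / 2)..s, w r n = v s n / freq n - v (t / 2) n / freq n := by
      refine intervalIntegral.integral_eq_sub_of_hasDerivAt (f := fun r => v r n / freq n)
        (fun r hr => ?_) hwn.intervalIntegrable
      have hr0 : 0 < r := hsub s hs hr
      refine ((h.solves r hr0 n).div_const (freq n)).congr_deriv ?_
      have h3 : v r n = V r n / freq n := by rw [← hVv r hr0]; rfl
      have key : ∀ k x y : ℝ, k ≠ 0 → (-k ^ 2 * (x / k) + k * y) / k = -x + y := by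
        intro k x y hk
        field_simp
        try ring
      rw [h3]
      exact key _ _ _ (freq_ne_zero n)
    rw [Seq.add_apply, h1, h2, divFreq_apply, divFreq_apply]
    ring
  have hd : HasDerivAt (fun s => divFreq (v (t / 2)) + ∫ r in (t / 2)..s, w r) (w t) t := by
    refine (intervalIntegral.integral_hasDerivAt_right (hint t (by linarith)) ?_ ?_).const_add _
    · exact hwc.stronglyMeasurableAtFilter isOpen_Ioi t ht
    · exact hwc.continuousAt (Ioi_mem_nhds ht)
  refine hd.congr_of_eventuallyEq ?_
  filter_upwards [lt_mem_nhds (show t / 2 < t by linarith)] with s hs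
  exact heq s hs

/-! ### The trigonometric system in L²(-π, π) and odd functions. -/

theorem integral_period (f : ℝ → ℝ) :
    ∫ x, f x ∂period = ∫ x in (-Real.pi)..Real.pi, f x :=
  (intervalIntegral.integral_of_le (by linarith [Real.pi_pos])).symm

/-- The normalized sine `x ↦ π^{-1/2} sin((n+1)x)`. -/
noncomputable def sinB (n : ℕ) : BoundedContinuousFunction ℝ ℝ :=
  BoundedContinuousFunction.ofNormedAddCommGroup (fun x => Real.sin (freq n * x) / √Real.pi)
    (by fun_prop) (1 / √Real.pi) fun x => by
      rw [norm_div, Real.norm_of_nonneg (Real.sqrt_nonneg _)]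
      exact div_le_div_of_nonneg_right (Real.abs_sin_le_one _) (Real.sqrt_nonneg _)

/-- The normalized cosine `x ↦ π^{-1/2} cos((n+1)x)`. -/
noncomputable def cosB (n : ℕ) : BoundedContinuousFunction ℝ ℝ :=
  BoundedContinuousFunction.ofNormedAddCommGroup (fun x => Real.cos (freq n * x) / √Real.pi)
    (by fun_prop) (1 / √Real.pi) fun x => by
      rw [norm_div, Real.norm_of_nonneg (Real.sqrt_nonneg _)]
      exact div_le_div_of_nonneg_right (Real.abs_cos_le_one _) (Real.sqrt_nonneg _)

theorem sinB_apply (n : ℕ) (x : ℝ) : sinB n x = Real.sin (freq n * x) / √Real.pi := rfl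

theorem cosB_apply (n : ℕ) (x : ℝ) : cosB n x = Real.cos (freq n * x) / √Real.pi := rfl

theorem one_div_sqrt_pi_le_one : 1 / √Real.pi ≤ 1 := by
  rw [div_le_one (Real.sqrt_pos.2 Real.pi_pos)]
  exact Real.one_le_sqrt.2 (by linarith [Real.pi_gt_three])

theorem norm_sinB_le (n : ℕ) : ‖sinB n‖ ≤ 1 :=
  (BoundedContinuousFunction.norm_ofNormedAddCommGroup_le _ (by positivity) _).trans
    one_div_sqrt_pi_le_one

theorem norm_cosB_le (n : ℕ) : ‖cosB n‖ ≤ 1 :=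
  (BoundedContinuousFunction.norm_ofNormedAddCommGroup_le _ (by positivity) _).trans
    one_div_sqrt_pi_le_one

theorem hasDerivAt_sinB (n : ℕ) (x : ℝ) : HasDerivAt (sinB n) (freq n * cosB n x) x := by
  have h := (((hasDerivAt_id x).const_mul (freq n)).sin).div_const (√Real.pi)
  refine h.congr_deriv ?_
  simp only [cosB_apply, id]
  ring

theorem hasDerivAt_cosB (n : ℕ) (x : ℝ) : HasDerivAt (cosB n) (-(freq n * sinB n x)) x := by
  have h := (((hasDerivAt_id x).const_mul (freq n)).cos).div_const (√Real.pi)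
  refine h.congr_deriv ?_
  simp only [sinB_apply, id]
  ring

/-- The class in `L²` of a bounded continuous function. -/
noncomputable def toL2 : BoundedContinuousFunction ℝ ℝ →L[ℝ] L2 :=
  BoundedContinuousFunction.toLp 2 period ℝ

theorem coeFn_toL2 (f : BoundedContinuousFunction ℝ ℝ) : toL2 f =ᵐ[period] f :=
  BoundedContinuousFunction.coeFn_toLp (p := 2) period ℝ f

theorem inner_eq_integral (f g : L2) : inner ℝ f g = ∫ x, f x * g x ∂period := by
  rw [L2.inner_def]
  congr 1
  funext x
  simp [mul_comm]

theorem inner_toL2 (f : BoundedContinuousFunction ℝ ℝ) (g : L2) :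
    inner ℝ (toL2 f) g = ∫ x, f x * g x ∂period := by
  rw [inner_eq_integral]
  refine integral_congr_ae ?_
  filter_upwards [coeFn_toL2 f] with x hx
  rw [hx]

theorem inner_toL2_toL2 (f g : BoundedContinuousFunction ℝ ℝ) :
    inner ℝ (toL2 f) (toL2 g) = ∫ x, f x * g x ∂period := by
  rw [inner_toL2]
  refine integral_congr_ae ?_
  filter_upwards [coeFn_toL2 g] with x hx
  rw [hx]

theorem integral_cos_int_mul {j : ℤ} (hj : j ≠ 0) :
    ∫ x in (-Real.pi)..Real.pi, Real.cos (j * x) = 0 := by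
  have hj' : (j : ℝ) ≠ 0 := by exact_mod_cast hj
  rw [intervalIntegral.integral_comp_mul_left _ hj', integral_cos, mul_neg, Real.sin_neg,
    Real.sin_int_mul_pi]
  simp

theorem integral_cos_mul_cos_add_sub (m n : ℕ) :
    (∫ x in (-Real.pi)..Real.pi, Real.cos (((m : ℤ) - n : ℤ) * x)) =
      if m = n then 2 * Real.pi else 0 := by
  split_ifs with h
  · subst h
    simp
    ring
  · exact integral_cos_int_mul (by omega)

theorem orthonormal_sin : Orthonormal ℝ fun n => toL2 (sinB n) := by
  rw [orthonormal_iff_ite]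
  intro m n
  rw [inner_toL2_toL2, integral_period]
  have h : ∀ x, sinB m x * sinB n x = (1 / (2 * Real.pi)) *
      (Real.cos (((m : ℤ) - n : ℤ) * x) - Real.cos (((m : ℤ) + n + 2 : ℤ) * x)) := fun x => by
    have h1 : ((((m : ℤ) - n : ℤ) : ℝ)) * x = freq m * x - freq n * x := by
      simp only [freq]; push_cast; ring
    have h2 : ((((m : ℤ) + n + 2 : ℤ) : ℝ)) * x = freq m * x + freq n * x := by
      simp only [freq]; push_cast; ring
    rw [h1, h2, Real.cos_sub, Real.cos_add, sinB_apply, sinB_apply, div_mul_div_comm,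
      Real.mul_self_sqrt Real.pi_pos.le]
    have := Real.pi_ne_zero
    field_simp
    ring
  simp only [h]
  rw [intervalIntegral.integral_const_mul, intervalIntegral.integral_sub
    (Continuous.intervalIntegrable (by fun_prop) _ _)
    (Continuous.intervalIntegrable (by fun_prop) _ _), integral_cos_mul_cos_add_sub,
    integral_cos_int_mul (by omega)]
  have := Real.pi_ne_zero
  split_ifs
  · field_simp
    ring
  · simp

theorem orthonormal_cos : Orthonormal ℝ fun n => toL2 (cosB n) := by
  rw [orthonormal_iff_ite]
  intro m n
  rw [inner_toL2_toL2, integral_period]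
  have h : ∀ x, cosB m x * cosB n x = (1 / (2 * Real.pi)) *
      (Real.cos (((m : ℤ) - n : ℤ) * x) + Real.cos (((m : ℤ) + n + 2 : ℤ) * x)) := fun x => by
    have h1 : ((((m : ℤ) - n : ℤ) : ℝ)) * x = freq m * x - freq n * x := by
      simp only [freq]; push_cast; ring
    have h2 : ((((m : ℤ) + n + 2 : ℤ) : ℝ)) * x = freq m * x + freq n * x := by
      simp only [freq]; push_cast; ring
    rw [h1, h2, Real.cos_sub, Real.cos_add, cosB_apply, cosB_apply, div_mul_div_comm,
      Real.mul_self_sqrt Real.pi_pos.le]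
    have := Real.pi_ne_zero
    field_simp
    ring
  simp only [h]
  rw [intervalIntegral.integral_const_mul, intervalIntegral.integral_add
    (Continuous.intervalIntegrable (by fun_prop) _ _)
    (Continuous.intervalIntegrable (by fun_prop) _ _), integral_cos_mul_cos_add_sub,
    integral_cos_int_mul (by omega)]
  have := Real.pi_ne_zero
  split_ifs
  · field_simp
    ring
  · simp

/-- Completeness of the trigonometric system in `L²(-π, π)`. -/
theorem eq_zero_of_inner_eq_zero {f : L2} (h0 : ∫ x, f x ∂period = 0)
    (hs : ∀ n, inner ℝ (toL2 (sinB n)) f = 0) (hc : ∀ n, inner ℝ (toL2 (cosB n)) f = 0) :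
    f = 0 := by
  have hπ : -Real.pi < Real.pi := by linarith [Real.pi_pos]
  have hsq : √Real.pi ≠ 0 := (Real.sqrt_pos.2 Real.pi_pos).ne'
  have hfi : Integrable f period := (Lp.memLp f).integrable (by norm_num)
  have hs' : ∀ n : ℕ, ∫ x, Real.sin (n * x) * f x ∂period = 0 := by
    intro n
    rcases n with _ | n
    · simp
    · have h1 := hs n
      rw [inner_toL2] at h1
      have h2 : ∀ x, sinB n x * f x = (√Real.pi)⁻¹ * (Real.sin ((n + 1 : ℕ) * x) * f x) := by
        intro x
        rw [sinB_apply, freq]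
        push_cast
        ring
      simp only [h2] at h1
      rw [integral_const_mul] at h1
      exact (mul_eq_zero.1 h1).resolve_left (inv_ne_zero hsq)
  have hc' : ∀ n : ℕ, ∫ x, Real.cos (n * x) * f x ∂period = 0 := by
    intro n
    rcases n with _ | n
    · simpa using h0
    · have h1 := hc n
      rw [inner_toL2] at h1
      have h2 : ∀ x, cosB n x * f x = (√Real.pi)⁻¹ * (Real.cos ((n + 1 : ℕ) * x) * f x) := by
        intro x
        rw [cosB_apply, freq]
        push_cast
        ring
      simp only [h2] at h1
      rw [integral_const_mul] at h1
      exact (mul_eq_zero.1 h1).resolve_left (inv_ne_zero hsq)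
  have hsZ : ∀ k : ℤ, ∫ x, Real.sin (k * x) * f x ∂period = 0 := by
    intro k
    obtain ⟨n, rfl | rfl⟩ := k.eq_nat_or_neg
    · exact_mod_cast hs' n
    · have := hs' n
      push_cast
      simp only [neg_mul, Real.sin_neg, integral_neg, this, neg_zero]
  have hcZ : ∀ k : ℤ, ∫ x, Real.cos (k * x) * f x ∂period = 0 := by
    intro k
    obtain ⟨n, rfl | rfl⟩ := k.eq_nat_or_neg
    · exact_mod_cast hc' n
    · have := hc' n
      push_cast
      simp only [neg_mul, Real.cos_neg, this]
  have hsi : ∀ k : ℤ, Integrable (fun x => Real.sin (k * x) * f x) period := fun k =>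
    hfi.bdd_mul (c := 1) (Continuous.aestronglyMeasurable (by fun_prop))
      (Eventually.of_forall fun x => Real.abs_sin_le_one _)
  have hci : ∀ k : ℤ, Integrable (fun x => Real.cos (k * x) * f x) period := fun k =>
    hfi.bdd_mul (c := 1) (Continuous.aestronglyMeasurable (by fun_prop))
      (Eventually.of_forall fun x => Real.abs_cos_le_one _)
  -- Real orthogonality makes all complex Fourier coefficients vanish; Parseval's identity then
  -- gives f = 0.
  have hcoef : ∀ k : ℤ, fourierCoeffOn hπ (fun x => (f x : ℂ)) k = 0 := by
    intro k
    rw [fourierCoeffOn_eq_integral, intervalIntegral.integral_of_le hπ.le]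
    have h1 : ∀ x : ℝ, fourier (-k) (x : AddCircle (Real.pi - -Real.pi)) • (f x : ℂ) =
        ((Real.cos (k * x) * f x : ℝ) : ℂ) - ((Real.sin (k * x) * f x : ℝ) : ℂ) * Complex.I := by
      intro x
      rw [fourier_coe_apply]
      have h2 : 2 * (Real.pi : ℂ) * Complex.I * ((-k : ℤ) : ℂ) * (x : ℂ) /
          ((Real.pi - -Real.pi : ℝ) : ℂ) = ((-(k * x) : ℝ) : ℂ) * Complex.I := by
        have : (Real.pi : ℂ) ≠ 0 := by exact_mod_cast Real.pi_ne_zero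
        push_cast
        field_simp
        ring
      rw [h2, Complex.exp_mul_I, ← Complex.ofReal_cos, ← Complex.ofReal_sin, Real.cos_neg,
        Real.sin_neg, smul_eq_mul]
      push_cast
      ring
    simp only [h1]
    rw [integral_sub (hci k).ofReal ((hsi k).ofReal.mul_const _), integral_mul_const,
      integral_complex_ofReal, integral_complex_ofReal, hcZ, hsZ]
    simp
  have hmem : MemLp (fun x => (f x : ℂ)) 2 (volume.restrict (Set.Ioc (-Real.pi) Real.pi)) :=
    (Lp.memLp f).ofReal
  have hpars := hasSum_sq_fourierCoeffOn hπ hmem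
  simp only [hcoef, norm_zero, ne_eq, OfNat.ofNat_ne_zero, not_false_eq_true, zero_pow,
    Complex.norm_real] at hpars
  have h3 := hpars.unique hasSum_zero
  rw [smul_eq_mul, mul_eq_zero] at h3
  have h4 := h3.resolve_left (inv_ne_zero (by linarith [Real.pi_pos]))
  rw [← integral_period] at h4
  have h5 : inner ℝ f f = 0 := by
    rw [inner_eq_integral, ← h4]
    congr 1
    funext x
    rw [Real.norm_eq_abs, sq_abs, sq]
  exact inner_self_eq_zero.1 h5

theorem measurePreserving_neg_period : MeasurePreserving (fun x : ℝ => -x) period period := by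
  have h := (Measure.measurePreserving_neg (volume : Measure ℝ)).restrict_preimage
    (s := Set.Ioc (-Real.pi) Real.pi) measurableSet_Ioc
  have h2 : (Neg.neg ⁻¹' Set.Ioc (-Real.pi) Real.pi : Set ℝ) = Set.Ico (-Real.pi) Real.pi := by
    ext x
    simp only [Set.mem_preimage, Set.mem_Ioc, Set.mem_Ico]
    constructor <;> rintro ⟨h1, h2⟩ <;> constructor <;> linarith
  rw [h2, Measure.restrict_congr_set Ico_ae_eq_Ioc] at h
  exact h

/-- Reflection `f ↦ f(-·)` on `L²`. -/
noncomputable def reflect : L2 →ₗᵢ[ℝ] L2 :=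
  Lp.compMeasurePreservingₗᵢ ℝ (fun x : ℝ => -x) measurePreserving_neg_period

theorem coeFn_reflect (f : L2) : reflect f =ᵐ[period] fun x => f (-x) :=
  Lp.coeFn_compMeasurePreserving f measurePreserving_neg_period

theorem ae_period_neg {p : ℝ → Prop} (h : ∀ᵐ x ∂period, p x) : ∀ᵐ x ∂period, p (-x) :=
  measurePreserving_neg_period.quasiMeasurePreserving.ae h

theorem isOdd_iff (f : L2) : IsOdd f ↔ reflect f = -f := by
  constructor
  · intro h
    apply Lp.ext
    filter_upwards [coeFn_reflect f, h, Lp.coeFn_neg f] with x h1 h2 h3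
    rw [h1, h2, h3]
    rfl
  · intro h
    have h1 := coeFn_reflect f
    rw [h] at h1
    filter_upwards [h1, Lp.coeFn_neg f] with x h2 h3
    rw [← h2, h3]
    rfl

theorem reflect_toL2 {f : BoundedContinuousFunction ℝ ℝ} {c : ℝ} (h : ∀ x, f (-x) = c * f x) :
    reflect (toL2 f) = c • toL2 f := by
  apply Lp.ext
  filter_upwards [coeFn_reflect (toL2 f), coeFn_toL2 f, ae_period_neg (coeFn_toL2 f),
    Lp.coeFn_smul c (toL2 f)] with x h1 h2 h3 h4
  rw [h1, h3, h4, h, Pi.smul_apply, h2, smul_eq_mul]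

theorem inner_eq_zero_of_odd {f g : L2} (hf : reflect f = f) (hg : IsOdd g) :
    inner ℝ f g = 0 := by
  have h := reflect.inner_map_map f g
  rw [hf, (isOdd_iff g).1 hg, inner_neg_right] at h
  linarith

theorem reflect_cosB (n : ℕ) : reflect (toL2 (cosB n)) = toL2 (cosB n) := by
  rw [reflect_toL2 (c := 1) fun x => by rw [cosB_apply, cosB_apply, mul_neg, Real.cos_neg, one_mul],
    one_smul]

theorem reflect_sinB (n : ℕ) : reflect (toL2 (sinB n)) = -toL2 (sinB n) := by
  rw [reflect_toL2 (c := -1) fun x => by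
    rw [sinB_apply, sinB_apply, mul_neg, Real.sin_neg]; ring, neg_smul, one_smul]

theorem sineCoeff_eq_inner (f : L2) (n : ℕ) : sineCoeff f n = inner ℝ (toL2 (sinB n)) f := by
  rw [inner_toL2, sineCoeff]
  congr 1
  funext x
  exact mul_comm _ _

/-- Completeness of the sines among odd functions. -/
theorem IsOdd.eq_zero {f : L2} (hf : IsOdd f) (h : ∀ n, inner ℝ (toL2 (sinB n)) f = 0) :
    f = 0 := by
  refine eq_zero_of_inner_eq_zero ?_ h fun n => inner_eq_zero_of_odd (reflect_cosB n) hf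
  have h1 := inner_eq_zero_of_odd (f := toL2 (BoundedContinuousFunction.const ℝ 1))
    (by rw [reflect_toL2 (c := 1) fun x => by simp, one_smul]) hf
  rw [inner_toL2] at h1
  simpa using h1

/-! ### Sine and cosine series as isometries from ℓ². -/

/-- The sine series with given coefficients. -/
noncomputable def sineSeries : Seq →ₗᵢ[ℝ] L2 := orthonormal_sin.orthogonalFamily.linearIsometry

/-- The cosine series with given coefficients. -/
noncomputable def cosineSeries : Seq →ₗᵢ[ℝ] L2 := orthonormal_cos.orthogonalFamily.linearIsometry

theorem sineSeries_single (n : ℕ) (a : ℝ) :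
    sineSeries (lp.single 2 n a) = a • toL2 (sinB n) := by
  rw [sineSeries, OrthogonalFamily.linearIsometry_apply_single]
  rfl

theorem cosineSeries_single (n : ℕ) (a : ℝ) :
    cosineSeries (lp.single 2 n a) = a • toL2 (cosB n) := by
  rw [cosineSeries, OrthogonalFamily.linearIsometry_apply_single]
  rfl

/-- Continuous linear maps on `Seq` that agree on the unit vectors are equal. -/
theorem Seq.clm_ext {E : Type*} [NormedAddCommGroup E] [NormedSpace ℝ E] {f g : Seq →L[ℝ] E}
    (h : ∀ n, f (lp.single 2 n 1) = g (lp.single 2 n 1)) : f = g := by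
  refine lp.ext_continuousLinearMap (by norm_num) fun n => ?_
  ext
  exact h n

theorem isOdd_sineSeries (x : Seq) : IsOdd (sineSeries x) := by
  rw [isOdd_iff]
  have h : reflect.toContinuousLinearMap.comp sineSeries.toContinuousLinearMap =
      -sineSeries.toContinuousLinearMap := Seq.clm_ext fun n => by
    change reflect (sineSeries _) = -sineSeries _
    rw [sineSeries_single, one_smul, reflect_sinB]
  exact DFunLike.congr_fun h x

theorem reflect_cosineSeries (x : Seq) : reflect (cosineSeries x) = cosineSeries x := by
  have h : reflect.toContinuousLinearMap.comp cosineSeries.toContinuousLinearMap =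
      cosineSeries.toContinuousLinearMap := Seq.clm_ext fun n => by
    change reflect (cosineSeries _) = cosineSeries _
    rw [cosineSeries_single, one_smul, reflect_cosB]
  exact DFunLike.congr_fun h x

/-- The sequence of sine coefficients. -/
noncomputable def sineCoeffs : L2 →L[ℝ] Seq :=
  ContinuousLinearMap.adjoint sineSeries.toContinuousLinearMap

/-- The sequence of cosine coefficients. -/
noncomputable def cosineCoeffs : L2 →L[ℝ] Seq :=
  ContinuousLinearMap.adjoint cosineSeries.toContinuousLinearMap

theorem sineCoeffs_apply (f : L2) (n : ℕ) : sineCoeffs f n = inner ℝ (toL2 (sinB n)) f := by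
  have h := lp.inner_single_left (𝕜 := ℝ) (G := fun _ : ℕ => ℝ) n (1 : ℝ) (sineCoeffs f)
  rw [sineCoeffs, ContinuousLinearMap.adjoint_inner_right] at h
  change inner ℝ (sineSeries _) f = _ at h
  rw [sineSeries_single, one_smul] at h
  rw [h, sineCoeffs]
  simp

theorem cosineCoeffs_apply (f : L2) (n : ℕ) :
    cosineCoeffs f n = inner ℝ (toL2 (cosB n)) f := by
  have h := lp.inner_single_left (𝕜 := ℝ) (G := fun _ : ℕ => ℝ) n (1 : ℝ) (cosineCoeffs f)
  rw [cosineCoeffs, ContinuousLinearMap.adjoint_inner_right] at h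
  change inner ℝ (cosineSeries _) f = _ at h
  rw [cosineSeries_single, one_smul] at h
  rw [h, cosineCoeffs]
  simp

theorem sineCoeffs_sineSeries (x : Seq) : sineCoeffs (sineSeries x) = x := by
  refine ext_inner_left ℝ fun y => ?_
  rw [sineCoeffs, ContinuousLinearMap.adjoint_inner_right]
  exact sineSeries.inner_map_map y x

theorem IsOdd.sub {f g : L2} (hf : IsOdd f) (hg : IsOdd g) : IsOdd (f - g) := by
  rw [isOdd_iff] at *
  rw [map_sub, hf, hg]
  abel

theorem IsOdd.sineSeries_sineCoeffs {f : L2} (hf : IsOdd f) : sineSeries (sineCoeffs f) = f := by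
  refine sub_eq_zero.1 (((isOdd_sineSeries _).sub hf).eq_zero fun n => ?_)
  rw [inner_sub_right, ← sineCoeffs_apply, ← sineCoeffs_apply, sineCoeffs_sineSeries, sub_self]

/-! ### Uniformly convergent series and integration by parts. -/

theorem summable_inv_freq_sq : Summable fun n => (1 / freq n) ^ 2 := by
  have h := (summable_nat_add_iff 1).2 (Real.summable_one_div_nat_pow.2 (by norm_num : 1 < 2))
  refine h.congr fun n => ?_
  rw [freq, div_pow, one_pow]
  push_cast
  rfl

/-- The sequence `1 / (n + 1)`. -/
noncomputable def invFreq : Seq := Seq.mk _ summable_inv_freq_sq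

/-- Cauchy–Schwarz against 1/(n+1). This is the one-dimensional Sobolev embedding of H¹ into bounded
functions. -/
theorem hasSum_abs_div_freq (x : Seq) :
    ∃ s, HasSum (fun n => |x n / freq n|) s ∧ s ≤ ‖x‖ * ‖invFreq‖ := by
  have habs : Summable fun n => |x n| ^ 2 := by simpa only [sq_abs] using x.hasSum_sq.summable
  set y : Seq := Seq.mk _ habs with hy
  have hyn : ‖y‖ = ‖x‖ := by
    have h1 : ‖y‖ ^ 2 = ‖x‖ ^ 2 := by
      rw [← y.hasSum_sq.tsum_eq, ← x.hasSum_sq.tsum_eq]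
      congr 1
      funext n
      exact sq_abs (x n)
    exact (sq_eq_sq₀ (norm_nonneg _) (norm_nonneg _)).1 h1
  have h2 := lp.hasSum_inner (𝕜 := ℝ) y invFreq
  refine ⟨_, h2.congr_fun ?_ |> fun h => h, ?_⟩
  · intro n
    change |x n / freq n| = 1 / freq n * |x n|
    rw [abs_div, abs_of_pos (freq_pos n)]
    ring
  · rw [← hyn]
    exact real_inner_le_norm _ _

theorem summable_abs_div_freq (x : Seq) : Summable fun n => |x n / freq n| := by
  obtain ⟨s, hs, _⟩ := hasSum_abs_div_freq x
  exact hs.summable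

theorem summable_smul_of_norm_le {e : ℕ → BoundedContinuousFunction ℝ ℝ} (he : ∀ n, ‖e n‖ ≤ 1)
    (x : Seq) : Summable fun n => (x n / freq n) • e n :=
  Summable.of_norm_bounded (summable_abs_div_freq x) fun n => by
    rw [norm_smul, Real.norm_eq_abs]
    exact mul_le_of_le_one_right (abs_nonneg _) (he n)

/-- The uniformly convergent series `∑ xₙ / (n + 1) eₙ`. -/
noncomputable def uniformSeries (e : ℕ → BoundedContinuousFunction ℝ ℝ) (he : ∀ n, ‖e n‖ ≤ 1) :
    Seq →L[ℝ] BoundedContinuousFunction ℝ ℝ :=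
  LinearMap.mkContinuous
    { toFun := fun x => ∑' n, (x n / freq n) • e n
      map_add' := fun x y => by
        rw [← (summable_smul_of_norm_le he x).tsum_add (summable_smul_of_norm_le he y)]
        congr 1
        funext n
        rw [Seq.add_apply, add_div, add_smul]
      map_smul' := fun c x => by
        rw [RingHom.id_apply, ← (summable_smul_of_norm_le he x).tsum_const_smul]
        congr 1
        funext n
        rw [Seq.smul_apply, mul_div_assoc, mul_smul] }
    ‖invFreq‖ fun x => by
      obtain ⟨s, hs, hle⟩ := hasSum_abs_div_freq x
      rw [mul_comm]
      refine le_trans (tsum_of_norm_bounded hs fun n => ?_) hle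
      rw [norm_smul, Real.norm_eq_abs]
      exact mul_le_of_le_one_right (abs_nonneg _) (he n)

theorem hasSum_uniformSeries {e : ℕ → BoundedContinuousFunction ℝ ℝ} (he : ∀ n, ‖e n‖ ≤ 1)
    (x : Seq) : HasSum (fun n => (x n / freq n) • e n) (uniformSeries e he x) :=
  (summable_smul_of_norm_le he x).hasSum

theorem hasSum_uniformSeries_apply {e : ℕ → BoundedContinuousFunction ℝ ℝ} (he : ∀ n, ‖e n‖ ≤ 1)
    (x : Seq) (t : ℝ) : HasSum (fun n => x n / freq n * e n t) (uniformSeries e he x t) :=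
  (BoundedContinuousFunction.evalCLM ℝ t).hasSum (hasSum_uniformSeries he x)

/-- Termwise differentiation. -/
theorem hasDerivAt_uniformSeries {e e' : ℕ → BoundedContinuousFunction ℝ ℝ}
    (he : ∀ n, ‖e n‖ ≤ 1) (he' : ∀ n, ‖e' n‖ ≤ 1)
    (hd : ∀ n t, HasDerivAt (e n) (freq n * e' n t) t) (x : Seq) (t : ℝ) :
    HasDerivAt (uniformSeries e he (divFreq x)) (uniformSeries e' he' x t) t := by
  have h1 : (uniformSeries e he (divFreq x) : ℝ → ℝ) =
      fun t => ∑' n, divFreq x n / freq n * e n t := by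
    funext t
    exact (hasSum_uniformSeries_apply he (divFreq x) t).tsum_eq.symm
  rw [h1, ← (hasSum_uniformSeries_apply he' x t).tsum_eq]
  have h0 : Summable fun n => divFreq x n / freq n * e n t :=
    (hasSum_uniformSeries_apply he (divFreq x) t).summable
  refine hasDerivAt_tsum (g := fun n t => divFreq x n / freq n * e n t)
    (g' := fun n t => x n / freq n * e' n t) (summable_abs_div_freq x) (fun n s => ?_)
    (fun n s => ?_) h0 t
  · have h2 : divFreq x n / freq n * (freq n * e' n s) = x n / freq n * e' n s := by
      rw [← mul_assoc, div_mul_cancel₀ _ (freq_ne_zero n), divFreq_apply]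
    exact h2 ▸ (hd n s).const_mul (divFreq x n / freq n)
  · rw [norm_mul, Real.norm_eq_abs]
    exact mul_le_of_le_one_right (abs_nonneg _)
      (((e' n).norm_coe_le_norm s).trans (he' n))

/-- The bounded continuous representative of `sineSeries (divFreq x)`. -/
noncomputable def sineSum : Seq →L[ℝ] BoundedContinuousFunction ℝ ℝ :=
  uniformSeries sinB norm_sinB_le

/-- The bounded continuous representative of `cosineSeries (divFreq x)`. -/
noncomputable def cosineSum : Seq →L[ℝ] BoundedContinuousFunction ℝ ℝ :=
  uniformSeries cosB norm_cosB_le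

theorem hasDerivAt_sineSum (x : Seq) (t : ℝ) :
    HasDerivAt (sineSum (divFreq x)) (cosineSum x t) t :=
  hasDerivAt_uniformSeries _ _ hasDerivAt_sinB x t

theorem hasDerivAt_cosineSum (x : Seq) (t : ℝ) :
    HasDerivAt (cosineSum (divFreq x)) (-sineSum x t) t := by
  have h := hasDerivAt_uniformSeries (e := cosB) (e' := fun n => -sinB n) norm_cosB_le
    (fun n => by rw [norm_neg]; exact norm_sinB_le n)
    (fun n t => by
      refine (hasDerivAt_cosB n t).congr_deriv ?_
      simp) x t
  have h2 : uniformSeries (fun n => -sinB n) (fun n => by rw [norm_neg]; exact norm_sinB_le n) x t =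
      -sineSum x t := by
    refine (hasSum_uniformSeries_apply _ x t).unique ?_
    have h3 := (hasSum_uniformSeries_apply norm_sinB_le x t).neg
    refine h3.congr_fun ?_ |> fun h => h
    intro n
    simp
  rw [h2] at h
  exact h

theorem toL2_uniformSeries {e : ℕ → BoundedContinuousFunction ℝ ℝ} (he : ∀ n, ‖e n‖ ≤ 1)
    {S : Seq →ₗᵢ[ℝ] L2} (hS : ∀ n a, S (lp.single 2 n a) = a • toL2 (e n)) (x : Seq) :
    toL2 (uniformSeries e he x) = S (divFreq x) := by
  have h1 := toL2.hasSum (hasSum_uniformSeries he x)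
  have h2 := S.toContinuousLinearMap.hasSum
    (lp.hasSum_single (E := fun _ : ℕ => ℝ) (p := 2) (by norm_num) (divFreq x))
  refine h1.unique (h2.congr_fun ?_ |> fun h => h)
  intro n
  change toL2 _ = S _
  rw [hS, map_smul, divFreq_apply]

theorem toL2_sineSum (x : Seq) : toL2 (sineSum x) = sineSeries (divFreq x) :=
  toL2_uniformSeries _ sineSeries_single x

theorem toL2_cosineSum (x : Seq) : toL2 (cosineSum x) = cosineSeries (divFreq x) :=
  toL2_uniformSeries _ cosineSeries_single x

theorem uniformSeries_eq {e : ℕ → BoundedContinuousFunction ℝ ℝ} (he : ∀ n, ‖e n‖ ≤ 1)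
    {s t : ℝ} (h : ∀ n, e n s = e n t) (x : Seq) :
    uniformSeries e he x s = uniformSeries e he x t := by
  have h1 := hasSum_uniformSeries_apply he x s
  simp only [h] at h1
  exact h1.unique (hasSum_uniformSeries_apply he x t)

theorem sin_freq_mul_pi (n : ℕ) : Real.sin (freq n * Real.pi) = 0 := by
  have := Real.sin_nat_mul_pi (n + 1)
  push_cast at this
  exact this

theorem sinB_boundary (n : ℕ) : sinB n Real.pi = sinB n (-Real.pi) := by
  rw [sinB_apply, sinB_apply, mul_neg, Real.sin_neg, sin_freq_mul_pi, neg_zero]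

theorem cosB_boundary (n : ℕ) : cosB n Real.pi = cosB n (-Real.pi) := by
  rw [cosB_apply, cosB_apply, mul_neg, Real.cos_neg]

theorem sineSum_boundary (x : Seq) : sineSum x Real.pi = sineSum x (-Real.pi) :=
  uniformSeries_eq _ sinB_boundary x

theorem cosineSum_boundary (x : Seq) : cosineSum x Real.pi = cosineSum x (-Real.pi) :=
  uniformSeries_eq _ cosB_boundary x

/-- Integration by parts over a period. -/
theorem integral_mul_deriv_period {p q p' q' : ℝ → ℝ} (hp : ∀ x, HasDerivAt p (p' x) x)
    (hq : ∀ x, HasDerivAt q (q' x) x) (hp' : Continuous p') (hq' : Continuous q')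
    (hpb : p Real.pi = p (-Real.pi)) (hqb : q Real.pi = q (-Real.pi)) :
    ∫ x, p x * q' x ∂period = -∫ x, p' x * q x ∂period := by
  rw [integral_period, integral_period,
    intervalIntegral.integral_mul_deriv_eq_deriv_mul (fun x _ => hp x) (fun x _ => hq x)
      (hp'.intervalIntegrable _ _) (hq'.intervalIntegrable _ _), hpb, hqb]
  ring

/-- Finite sequences lie in the range. Identities continuous in x thus need checking only for x =
`divFreq u`, where the sine sum is continuously differentiable and classical integration by parts
applies. -/
theorem denseRange_divFreq : DenseRange divFreq := by
  intro x
  have h := (lp.hasSum_single (E := fun _ : ℕ => ℝ) (p := 2) (by norm_num) x)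
  refine mem_closure_of_tendsto h (Eventually.of_forall fun s => ?_)
  refine ⟨∑ n ∈ s, lp.single 2 n (freq n * x n), ?_⟩
  rw [map_sum]
  refine Finset.sum_congr rfl fun n _ => ?_
  ext m
  rw [divFreq_apply]
  by_cases hmn : m = n
  · subst hmn
    rw [lp.single_apply_self, lp.single_apply_self, mul_div_cancel_left₀ _ (freq_ne_zero m)]
  · rw [lp.single_apply_ne _ _ _ hmn, lp.single_apply_ne _ _ _ hmn, zero_div]

/-! ### The Burgers nonlinearity. -/

/-- Multiplication of an `L²` function by a bounded continuous function. -/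
noncomputable def mulL2 : BoundedContinuousFunction ℝ ℝ →L[ℝ] L2 →L[ℝ] L2 :=
  ((ContinuousLinearMap.mul ℝ ℝ).holderL period ⊤ 2 2).comp
    (BoundedContinuousFunction.toLp ⊤ period ℝ)

theorem coeFn_mulL2 (f : BoundedContinuousFunction ℝ ℝ) (g : L2) :
    mulL2 f g =ᵐ[period] fun x => f x * g x := by
  have h1 := (ContinuousLinearMap.mul ℝ ℝ).coeFn_holder (r := 2)
    (BoundedContinuousFunction.toLp ⊤ period ℝ f) g
  have h2 := BoundedContinuousFunction.coeFn_toLp (p := ⊤) period ℝ f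
  filter_upwards [h1, h2] with x h3 h4
  change (ContinuousLinearMap.mul ℝ ℝ).holder 2 (BoundedContinuousFunction.toLp ⊤ period ℝ f) g x
    = _
  rw [h3, h4]
  rfl

theorem integral_mul_mulL2 (h f : BoundedContinuousFunction ℝ ℝ)
    (g : BoundedContinuousFunction ℝ ℝ) :
    inner ℝ (toL2 h) (mulL2 f (toL2 g)) = ∫ x, h x * (f x * g x) ∂period := by
  rw [inner_toL2]
  refine integral_congr_ae ?_
  filter_upwards [coeFn_mulL2 f (toL2 g), coeFn_toL2 g] with x h1 h2
  rw [h1, h2]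

/-- The bilinear form `-2 z_x y'` as a function, for `z = sineSum x`, `y' = cosineSeries y`. -/
noncomputable def productL2 : Seq →L[ℝ] Seq →L[ℝ] L2 :=
  (-2 : ℝ) • mulL2.bilinearComp sineSum cosineSeries.toContinuousLinearMap

theorem productL2_apply (x y : Seq) :
    productL2 x y = (-2 : ℝ) • mulL2 (sineSum x) (cosineSeries y) := rfl

/-- The sine coefficients of `productL2`. -/
noncomputable def burgers : Seq →L[ℝ] Seq →L[ℝ] Seq :=
  (ContinuousLinearMap.compL ℝ Seq L2 Seq sineCoeffs).comp productL2

theorem burgers_apply (x y : Seq) : burgers x y = sineCoeffs (productL2 x y) := rfl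

theorem sineSum_neg (x : Seq) (t : ℝ) : sineSum x (-t) = -sineSum x t := by
  have h1 := hasSum_uniformSeries_apply norm_sinB_le x (-t)
  have h2 : ∀ n, x n / freq n * sinB n (-t) = -(x n / freq n * sinB n t) := fun n => by
    rw [sinB_apply, sinB_apply, mul_neg, Real.sin_neg]
    ring
  simp only [h2] at h1
  exact h1.unique (hasSum_uniformSeries_apply norm_sinB_le x t).neg

/-- An odd function times an even one. Hence the sine coefficients lose no information about the
product. -/
theorem isOdd_productL2 (x y : Seq) : IsOdd (productL2 x y) := by
  have h1 : productL2 x y =ᵐ[period] fun t => -2 * (sineSum x t * cosineSeries y t) := by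
    filter_upwards [Lp.coeFn_smul (-2 : ℝ) (mulL2 (sineSum x) (cosineSeries y)),
      coeFn_mulL2 (sineSum x) (cosineSeries y)] with t h2 h3
    rw [productL2_apply, h2, Pi.smul_apply, h3, smul_eq_mul]
  have h2 : ∀ᵐ t ∂period, cosineSeries y (-t) = cosineSeries y t := by
    have h3 := coeFn_reflect (cosineSeries y)
    rw [reflect_cosineSeries] at h3
    filter_upwards [h3] with t h4
    exact h4.symm
  filter_upwards [h1, ae_period_neg h1, h2] with t h3 h4 h5
  rw [h3, h4, h5, sineSum_neg]
  ring

theorem sineSeries_burgers (x y : Seq) : sineSeries (burgers x y) = productL2 x y :=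
  (isOdd_productL2 x y).sineSeries_sineCoeffs

/-- The Burgers nonlinearity does no work. -/
theorem inner_divFreq_burgers (x : Seq) : inner ℝ (divFreq x) (burgers x x) = 0 := by
  refine denseRange_divFreq.induction_on (p := fun x => inner ℝ (divFreq x) (burgers x x) = 0) x
    (isClosed_eq (by fun_prop) continuous_const) fun u => ?_
  set s := sineSum (divFreq u) with hs
  set q := cosineSum u with hq
  have h1 : inner ℝ (divFreq (divFreq u)) (burgers (divFreq u) (divFreq u)) =
      inner ℝ (toL2 s) ((-2 : ℝ) • mulL2 s (toL2 q)) := by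
    rw [← sineSeries.inner_map_map, sineSeries_burgers, productL2_apply, hs, hq, toL2_sineSum,
      toL2_cosineSum]
  rw [h1, inner_smul_right, integral_mul_mulL2]
  have hd : ∀ x, HasDerivAt s (q x) x := hasDerivAt_sineSum u
  -- Integration by parts gives ∫ s² s' = -2 ∫ s² s', so the integral vanishes.
  have h2 := integral_mul_deriv_period (p := fun x => s x ^ 2) (q := s)
    (p' := fun x => 2 * s x * q x) (q' := q)
    (fun x => by
      refine ((hd x).fun_pow 2).congr_deriv ?_
      norm_num) hd (by fun_prop) (by fun_prop)
    (by rw [hs, sineSum_boundary]) (sineSum_boundary _)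
  have h3 : ∫ x, 2 * s x * q x * s x ∂period = 2 * ∫ x, s x * (s x * q x) ∂period := by
    rw [← integral_const_mul]
    congr 1
    funext x
    ring
  have h4 : ∫ x, s x ^ 2 * q x ∂period = ∫ x, s x * (s x * q x) ∂period := by
    congr 1
    funext x
    ring
  rw [h3, h4] at h2
  have h5 : ∫ x, s x * (s x * q x) ∂period = 0 := by linarith
  rw [h5, mul_zero]

/-- Multiplying sine coefficients by n + 1 amounts to differentiating, and (s s')' = s'² + s s''. In
each product one factor is bounded uniformly and the other in L², which gives an estimate linear in
the stronger norm. -/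
theorem preservesRegularity_burgers : PreservesRegularity burgers := by
  refine ⟨2 * (‖mulL2‖ * ‖cosineSum‖ + ‖mulL2‖ * ‖sineSum‖), fun V => ?_⟩
  -- This is -2 (s s')' with s'' = -`sineSeries V`, which explains the minus sign inside.
  set Q : Seq → L2 := fun V => (-2 : ℝ) • (mulL2 (cosineSum V) (cosineSeries (divFreq V)) -
    mulL2 (sineSum (divFreq V)) (sineSeries V)) with hQ
  refine ⟨cosineCoeffs (Q V), fun n => ?_, ?_⟩
  · refine denseRange_divFreq.induction_on (p := fun V => cosineCoeffs (Q V) n =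
      freq n * burgers (divFreq V) (divFreq V) n) V (isClosed_eq ?_ ?_) fun u => ?_
    · refine (Seq.continuous_apply n).comp ?_
      fun_prop
    · refine continuous_const.mul ((Seq.continuous_apply n).comp ?_)
      fun_prop
    set s := sineSum (divFreq (divFreq u)) with hs
    set q := cosineSum (divFreq u) with hq
    set r := sineSum u with hr
    have hsd : ∀ x, HasDerivAt s (q x) x := hasDerivAt_sineSum _
    have hqd : ∀ x, HasDerivAt q (-r x) x := hasDerivAt_cosineSum _
    have h1 : cosineCoeffs (Q (divFreq u)) n =
        -2 * (∫ x, cosB n x * (q x * q x) ∂period - ∫ x, cosB n x * (s x * r x) ∂period) := by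
      rw [cosineCoeffs_apply, hQ]
      simp only
      rw [inner_smul_right, inner_sub_right, ← toL2_cosineSum, ← toL2_sineSum,
        integral_mul_mulL2, integral_mul_mulL2]
    have h2 : burgers (divFreq (divFreq u)) (divFreq (divFreq u)) n =
        -2 * ∫ x, sinB n x * (s x * q x) ∂period := by
      rw [burgers_apply, sineCoeffs_apply, productL2_apply, inner_smul_right, ← toL2_cosineSum,
        integral_mul_mulL2]
    have h3 := integral_mul_deriv_period (p := fun x => s x * q x) (q := cosB n)
      (p' := fun x => q x * q x + s x * -r x) (q' := fun x => -(freq n * sinB n x))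
      (fun x => (hsd x).mul (hqd x)) (hasDerivAt_cosB n) (by fun_prop) (by fun_prop)
      (by simp only [hs, hq, sineSum_boundary, cosineSum_boundary]) (cosB_boundary n)
    have hi : ∀ f : ℝ → ℝ, Continuous f → Integrable f period := fun f hf => hf.integrableOn_Ioc
    have h4 : ∫ x, (s x * q x) * -(freq n * sinB n x) ∂period =
        -(freq n * ∫ x, sinB n x * (s x * q x) ∂period) := by
      rw [← integral_const_mul, ← integral_neg]
      congr 1
      funext x
      ring
    have h5 : ∫ x, (q x * q x + s x * -r x) * cosB n x ∂period =
        ∫ x, cosB n x * (q x * q x) ∂period - ∫ x, cosB n x * (s x * r x) ∂period := by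
      rw [← integral_sub (hi _ (by fun_prop)) (hi _ (by fun_prop))]
      congr 1
      funext x
      ring
    rw [h4, h5] at h3
    rw [h1, h2]
    linarith
  · have h1 : ‖cosineCoeffs (Q V)‖ ≤ ‖Q V‖ := by
      refine (cosineCoeffs.le_opNorm _).trans (mul_le_of_le_one_left (norm_nonneg _) ?_)
      rw [cosineCoeffs, LinearIsometryEquiv.norm_map]
      exact cosineSeries.norm_toContinuousLinearMap_le
    have h2 : ‖mulL2 (cosineSum V) (cosineSeries (divFreq V))‖ ≤
        ‖mulL2‖ * (‖cosineSum‖ * ‖V‖) * ‖divFreq V‖ := by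
      refine (mulL2.le_opNorm₂ _ _).trans ?_
      rw [cosineSeries.norm_map]
      gcongr
      exact cosineSum.le_opNorm V
    have h3 : ‖mulL2 (sineSum (divFreq V)) (sineSeries V)‖ ≤
        ‖mulL2‖ * (‖sineSum‖ * ‖divFreq V‖) * ‖V‖ := by
      refine (mulL2.le_opNorm₂ _ _).trans ?_
      rw [sineSeries.norm_map]
      gcongr
      exact sineSum.le_opNorm _
    have h4 : ‖Q V‖ ≤ 2 * (‖mulL2 (cosineSum V) (cosineSeries (divFreq V))‖ +
        ‖mulL2 (sineSum (divFreq V)) (sineSeries V)‖) := by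
      rw [hQ]
      simp only
      rw [norm_smul]
      norm_num
      exact norm_sub_le _ _
    nlinarith

/-! ### Periodic weak derivatives. -/

/-- A continuous periodic function as a bounded continuous function. -/
theorem exists_boundedContinuous {φ : ℝ → ℝ} (hc : Continuous φ)
    (hp : Function.Periodic φ (2 * Real.pi)) :
    ∃ f : BoundedContinuousFunction ℝ ℝ, ∀ x, f x = φ x := by
  obtain ⟨C, hC⟩ := (isCompact_Icc (a := (0 : ℝ)) (b := 2 * Real.pi)).bddAbove_image
    hc.norm.continuousOn
  refine ⟨BoundedContinuousFunction.ofNormedAddCommGroup φ hc C fun x => ?_, fun x => rfl⟩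
  obtain ⟨y, hy, hxy⟩ := hp.exists_mem_Ico₀ (by linarith [Real.pi_pos]) x
  rw [hxy]
  exact hC ⟨y, ⟨hy.1, hy.2.le⟩, rfl⟩

theorem periodic_deriv {φ : ℝ → ℝ} {T : ℝ} (hp : Function.Periodic φ T) :
    Function.Periodic (deriv φ) T := fun x => by
  rw [← deriv_comp_add_const]
  congr 1
  funext y
  exact hp y

theorem periodic_boundary {φ : ℝ → ℝ} (hp : Function.Periodic φ (2 * Real.pi)) :
    φ Real.pi = φ (-Real.pi) := by
  rw [← hp (-Real.pi)]
  congr 1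
  ring

/-- Weak differentiability of limits of smooth functions. -/
theorem hasWeakDeriv_of_dense {F G : Seq →L[ℝ] L2}
    (h : ∀ u : Seq, ∃ p q : BoundedContinuousFunction ℝ ℝ, F (divFreq u) = toL2 p ∧
      G (divFreq u) = toL2 q ∧ (∀ x, HasDerivAt p (q x) x) ∧ p Real.pi = p (-Real.pi)) (x : Seq) :
    HasWeakDeriv (F x) (G x) := by
  intro φ hφ hper
  have hφ1 : ContDiff ℝ 1 φ := hφ.of_le (by exact_mod_cast le_top)
  have hcd : Continuous (deriv φ) := hφ1.continuous_deriv le_rfl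
  obtain ⟨f, hf⟩ := exists_boundedContinuous hφ.continuous hper
  obtain ⟨f', hf'⟩ := exists_boundedContinuous hcd (periodic_deriv hper)
  have hi : ∀ (g : BoundedContinuousFunction ℝ ℝ) (ψ : ℝ → ℝ) (w : L2), (∀ x, g x = ψ x) →
      ∫ x, w x * ψ x ∂period = inner ℝ (toL2 g) w := fun g ψ w hg => by
    rw [inner_toL2]
    congr 1
    funext x
    rw [hg, mul_comm]
  rw [hi f' _ _ hf', hi f _ _ hf]
  refine denseRange_divFreq.induction_on
    (p := fun x => inner ℝ (toL2 f') (F x) = -inner ℝ (toL2 f) (G x)) x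
    (isClosed_eq (by fun_prop) (by fun_prop)) fun u => ?_
  obtain ⟨p, q, hp, hq, hd, hb⟩ := h u
  rw [hp, hq, inner_toL2_toL2, inner_toL2_toL2]
  have h1 := integral_mul_deriv_period (p := p) (q := φ) (q' := deriv φ) hd
    (fun x => (hφ1.differentiable one_ne_zero x).hasDerivAt) q.continuous hcd hb
    (periodic_boundary hper)
  simp only [hf, hf']
  simp only [mul_comm] at h1 ⊢
  exact h1

theorem hasWeakDeriv_sineSeries (x : Seq) :
    HasWeakDeriv (sineSeries (divFreq x)) (cosineSeries x) :=
  hasWeakDeriv_of_dense (F := sineSeries.toContinuousLinearMap.comp divFreq)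
    (G := cosineSeries.toContinuousLinearMap)
    (fun u => ⟨sineSum (divFreq u), cosineSum u, (toL2_sineSum _).symm, (toL2_cosineSum _).symm,
      hasDerivAt_sineSum u, sineSum_boundary _⟩) x

theorem hasWeakDeriv_cosineSeries (x : Seq) :
    HasWeakDeriv (cosineSeries (divFreq x)) (-sineSeries x) :=
  hasWeakDeriv_of_dense (F := cosineSeries.toContinuousLinearMap.comp divFreq)
    (G := -sineSeries.toContinuousLinearMap)
    (fun u => ⟨cosineSum (divFreq u), -sineSum u, (toL2_cosineSum _).symm, by
      rw [map_neg, toL2_sineSum]; rfl, hasDerivAt_cosineSum u, cosineSum_boundary _⟩) x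

theorem freq_mul_add_two_pi (n : ℕ) (x : ℝ) :
    freq n * (x + 2 * Real.pi) = freq n * x + (n + 1 : ℕ) * (2 * Real.pi) := by
  rw [freq]
  push_cast
  ring

theorem periodic_sinB (n : ℕ) : Function.Periodic (sinB n) (2 * Real.pi) := fun x => by
  rw [sinB_apply, sinB_apply, freq_mul_add_two_pi, Real.sin_add_nat_mul_two_pi]

theorem periodic_cosB (n : ℕ) : Function.Periodic (cosB n) (2 * Real.pi) := fun x => by
  rw [cosB_apply, cosB_apply, freq_mul_add_two_pi, Real.cos_add_nat_mul_two_pi]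

theorem contDiff_sinB (n : ℕ) : ContDiff ℝ ∞ (sinB n) := by
  change ContDiff ℝ ∞ fun x => Real.sin (freq n * x) / √Real.pi
  fun_prop

theorem contDiff_cosB (n : ℕ) : ContDiff ℝ ∞ (cosB n) := by
  change ContDiff ℝ ∞ fun x => Real.cos (freq n * x) / √Real.pi
  fun_prop

theorem HasWeakDeriv.inner_cosB {f g : L2} (h : HasWeakDeriv f g) (n : ℕ) :
    inner ℝ (toL2 (cosB n)) g = freq n * inner ℝ (toL2 (sinB n)) f := by
  have h1 := h _ (contDiff_cosB n) (periodic_cosB n)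
  have h2 : ∫ x, f x * deriv (cosB n) x ∂period = -(freq n * ∫ x, sinB n x * f x ∂period) := by
    rw [← integral_const_mul, ← integral_neg]
    congr 1
    funext x
    rw [(hasDerivAt_cosB n x).deriv]
    ring
  rw [h2, neg_inj] at h1
  rw [inner_toL2, inner_toL2, h1]
  simp only [mul_comm]

theorem HasWeakDeriv.inner_sinB {f g : L2} (h : HasWeakDeriv f g) (n : ℕ) :
    inner ℝ (toL2 (sinB n)) g = -(freq n * inner ℝ (toL2 (cosB n)) f) := by
  have h1 := h _ (contDiff_sinB n) (periodic_sinB n)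
  have h2 : ∫ x, f x * deriv (sinB n) x ∂period = freq n * ∫ x, cosB n x * f x ∂period := by
    rw [← integral_const_mul]
    congr 1
    funext x
    rw [(hasDerivAt_sinB n x).deriv]
    ring
  rw [h2] at h1
  rw [inner_toL2, inner_toL2, h1, neg_neg]
  simp only [mul_comm]

theorem HasWeakDeriv.integral_eq_zero {f g : L2} (h : HasWeakDeriv f g) :
    ∫ x, g x ∂period = 0 := by
  have h1 := h (fun _ => 1) contDiff_const fun _ => rfl
  simpa using h1

/-- Sines, cosines and constants are admissible test functions and determine every Fourier
coefficient of the derivative. -/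
theorem HasWeakDeriv.unique {f g g' : L2} (h : HasWeakDeriv f g) (h' : HasWeakDeriv f g') :
    g = g' := by
  refine sub_eq_zero.1 (eq_zero_of_inner_eq_zero ?_ (fun n => ?_) fun n => ?_)
  · have hi : ∀ w : L2, Integrable w period := fun w => (Lp.memLp w).integrable (by norm_num)
    rw [integral_congr_ae (Lp.coeFn_sub g g')]
    simp only [Pi.sub_apply]
    rw [integral_sub (hi g) (hi g'), h.integral_eq_zero, h'.integral_eq_zero, sub_self]
  · rw [inner_sub_right, h.inner_sinB, h'.inner_sinB, sub_self]
  · rw [inner_sub_right, h.inner_cosB, h'.inner_cosB, sub_self]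

theorem inner_sinB_sineSeries_divFreq (x : Seq) (n : ℕ) :
    inner ℝ (toL2 (sinB n)) (sineSeries (divFreq x)) = x n / freq n := by
  rw [← sineCoeffs_apply, sineCoeffs_sineSeries, divFreq_apply]

theorem sineSeries_divFreq_injective : Function.Injective fun x => sineSeries (divFreq x) := by
  intro x y h
  ext n
  have h1 := inner_sinB_sineSeries_divFreq x n
  have h2 := inner_sinB_sineSeries_divFreq y n
  simp only at h
  rw [h, h2] at h1
  exact ((div_left_inj' (freq_ne_zero n)).1 h1).symm

/-! ### The space 𝓑^{1/2} and its norm in terms of ℓ². -/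

section FracSpace

variable {αr a : ℝ}

/-- After division by (n+1)², which is at least 1, the eigenvalue lies between the minimum of its
first value and its limit, and αr + |a - 2|. Positivity of the lower constant is exactly the
condition on a. -/
theorem exists_eigenvalue_bounds (hαr : 0 < αr) (ha : 2 - αr < a) :
    ∃ c₁ c₂ : ℝ, 0 < c₁ ∧ 0 < c₂ ∧ ∀ n, c₁ * freq n ^ 2 ≤ eigenvalue αr a n ∧
      eigenvalue αr a n ≤ c₂ * freq n ^ 2 := by
  refine ⟨min αr (αr - 2 + a), αr + |a - 2|, lt_min hαr (by linarith), by positivity,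
    fun n => ?_⟩
  have h1 : 1 ≤ freq n ^ 2 := one_le_pow₀ (one_le_freq n)
  have h2 : eigenvalue αr a n = αr * freq n ^ 2 - 2 + a := rfl
  rw [h2]
  constructor
  · have h3 := min_le_left αr (αr - 2 + a)
    have h4 := min_le_right αr (αr - 2 + a)
    nlinarith
  · have h3 := le_abs_self (a - 2)
    have h4 := abs_nonneg (a - 2)
    nlinarith

theorem rpow_half_mul_sq {e : ℝ} (he : 0 ≤ e) (b : ℝ) : (e ^ (1 / 2 : ℝ) * b) ^ 2 = e * b ^ 2 := by
  rw [mul_pow, ← Real.sqrt_eq_rpow, Real.sq_sqrt he]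

theorem eigenvalue_pos (hαr : 0 < αr) (ha : 2 - αr < a) (n : ℕ) : 0 < eigenvalue αr a n := by
  obtain ⟨c₁, c₂, h1, -, h⟩ := exists_eigenvalue_bounds hαr ha
  exact (mul_pos h1 (pow_pos (freq_pos n) 2)).trans_le (h n).1

theorem eigenvalue_term_bounds (hαr : 0 < αr) (ha : 2 - αr < a) :
    ∃ c₁ c₂ : ℝ, 0 < c₁ ∧ 0 < c₂ ∧ ∀ n b,
      c₁ * (freq n * b) ^ 2 ≤ (eigenvalue αr a n ^ (1 / 2 : ℝ) * b) ^ 2 ∧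
      (eigenvalue αr a n ^ (1 / 2 : ℝ) * b) ^ 2 ≤ c₂ * (freq n * b) ^ 2 := by
  obtain ⟨c₁, c₂, h1, h2, h⟩ := exists_eigenvalue_bounds hαr ha
  refine ⟨c₁, c₂, h1, h2, fun n b => ?_⟩
  rw [rpow_half_mul_sq (eigenvalue_pos hαr ha n).le, mul_pow, ← mul_assoc, ← mul_assoc]
  exact ⟨mul_le_mul_of_nonneg_right (h n).1 (sq_nonneg _),
    mul_le_mul_of_nonneg_right (h n).2 (sq_nonneg _)⟩

theorem freq_mul_sineCoeff (x : Seq) (n : ℕ) :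
    freq n * sineCoeff (sineSeries (divFreq x)) n = x n := by
  rw [sineCoeff_eq_inner, inner_sinB_sineSeries_divFreq, mul_div_cancel₀ _ (freq_ne_zero n)]

theorem mem_fracSpace_iff (hαr : 0 < αr) (ha : 2 - αr < a) {f : L2} :
    f ∈ fracSpace αr a (1 / 2) ↔ ∃ x, f = sineSeries (divFreq x) := by
  obtain ⟨c₁, c₂, h1, h2, h⟩ := eigenvalue_term_bounds hαr ha
  constructor
  · rintro ⟨hodd, hs⟩
    have h3 : Summable fun n => (freq n * sineCoeff f n) ^ 2 :=
      Summable.of_nonneg_of_le (fun _ => sq_nonneg _)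
        (fun n => by
          rw [le_div_iff₀' h1]
          exact (h n _).1) (hs.div_const c₁)
    refine ⟨Seq.mk _ h3, ?_⟩
    refine hodd.sineSeries_sineCoeffs.symm.trans (congrArg sineSeries ?_)
    ext n
    change sineCoeffs f n = freq n * sineCoeff f n / freq n
    rw [mul_div_cancel_left₀ _ (freq_ne_zero n), sineCoeffs_apply, sineCoeff_eq_inner]
  · rintro ⟨x, rfl⟩
    refine ⟨isOdd_sineSeries _, Summable.of_nonneg_of_le (fun _ => sq_nonneg _)
      (fun n => (h n _).2) ?_⟩
    simp only [freq_mul_sineCoeff]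
    exact x.hasSum_sq.summable.mul_left c₂

theorem exists_fracNorm_bounds (hαr : 0 < αr) (ha : 2 - αr < a) :
    ∃ c₁ c₂ : ℝ, 0 < c₁ ∧ 0 < c₂ ∧ ∀ x : Seq,
      c₁ * ‖x‖ ≤ fracNorm αr a (1 / 2) (sineSeries (divFreq x)) ∧
      fracNorm αr a (1 / 2) (sineSeries (divFreq x)) ≤ c₂ * ‖x‖ := by
  obtain ⟨c₁, c₂, h1, h2, h⟩ := eigenvalue_term_bounds hαr ha
  refine ⟨√c₁, √c₂, Real.sqrt_pos.2 h1, Real.sqrt_pos.2 h2, fun x => ?_⟩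
  have hmem := (mem_fracSpace_iff hαr ha).2 ⟨x, rfl⟩
  have hs := hmem.2.hasSum
  have hl : ∀ n, c₁ * x n ^ 2 ≤
      (eigenvalue αr a n ^ (1 / 2 : ℝ) * sineCoeff (sineSeries (divFreq x)) n) ^ 2 := fun n => by
    have h3 := (h n (sineCoeff (sineSeries (divFreq x)) n)).1
    rwa [freq_mul_sineCoeff] at h3
  have hu : ∀ n, (eigenvalue αr a n ^ (1 / 2 : ℝ) * sineCoeff (sineSeries (divFreq x)) n) ^ 2 ≤
      c₂ * x n ^ 2 := fun n => by
    have h3 := (h n (sineCoeff (sineSeries (divFreq x)) n)).2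
    rwa [freq_mul_sineCoeff] at h3
  have hc : ∀ c : ℝ, 0 ≤ c → √c * ‖x‖ = √(c * ‖x‖ ^ 2) := fun c hc => by
    rw [Real.sqrt_mul hc, Real.sqrt_sq (norm_nonneg _)]
  rw [hc c₁ h1.le, hc c₂ h2.le]
  exact ⟨Real.sqrt_le_sqrt (hasSum_le hl (x.hasSum_sq.mul_left c₁) hs),
    Real.sqrt_le_sqrt (hasSum_le hu hs (x.hasSum_sq.mul_left c₂))⟩

end FracSpace

/-! ### Solutions of the initial value problem correspond to flows. -/

theorem coeFn_smul_productL2 (α : ℝ) (x : Seq) :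
    ∀ᵐ t ∂period, (α • productL2 x x) t =
      -2 * α * cosineSeries x t * sineSeries (divFreq x) t := by
  have h := coeFn_toL2 (sineSum x)
  rw [toL2_sineSum] at h
  filter_upwards [h, Lp.coeFn_smul α (productL2 x x),
    Lp.coeFn_smul (-2 : ℝ) (mulL2 (sineSum x) (cosineSeries x)),
    coeFn_mulL2 (sineSum x) (cosineSeries x)] with t h1 h2 h3 h4
  rw [h2, Pi.smul_apply, productL2_apply, h3, Pi.smul_apply, h4, h1, smul_eq_mul, smul_eq_mul]
  ring

/-- The coefficient of the nonlinearity after the growing factor `e^{2t}` has been removed and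
time has been rescaled by `α`. -/
noncomputable def growth (α τ : ℝ) : ℝ := Real.exp (2 * τ / α)

theorem continuous_growth (α : ℝ) : Continuous (growth α) := by
  unfold growth
  fun_prop

theorem growth_pos (α τ : ℝ) : 0 < growth α τ := Real.exp_pos _

theorem monotone_growth {α : ℝ} (hα : 0 < α) : Monotone (growth α) := fun s t hst => by
  unfold growth
  gcongr

/-- The function of time and space described by a flow. -/
noncomputable def waveform (α : ℝ) (v : ℝ → Seq) (t : ℝ) : L2 :=
  sineSeries (divFreq (Real.exp (2 * t) • v (α * t)))

/-- Continuity into 𝓑^{1/2} is continuity of the flow in ℓ². Membership in D(A) and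
differentiability in L² come from the derivative gained by smoothing. -/
theorem isSolution_waveform {αr a α : ℝ} (hαr : 0 < αr) (ha : 2 - αr < a) (hα : 0 < α)
    {v : ℝ → Seq} (h : IsFlow burgers (growth α) v) :
    IsSolution αr a α (sineSeries (divFreq (v 0))) (waveform α v) := by
  have hv := h.cont
  refine ⟨fun t _ => (mem_fracSpace_iff hαr ha).2 ⟨_, rfl⟩, fun t _ => ?_, ?_, fun t ht => ?_⟩
  · obtain ⟨c₁, c₂, -, -, hc⟩ := exists_fracNorm_bounds hαr ha
    have hx : Continuous fun s => Real.exp (2 * s) • v (α * s) := by fun_prop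
    have h1 : Tendsto (fun s => c₂ * ‖Real.exp (2 * s) • v (α * s) -
        Real.exp (2 * t) • v (α * t)‖) (𝓝[Set.Ici 0] t) (𝓝 0) := by
      have h2 : Continuous fun s => c₂ * ‖Real.exp (2 * s) • v (α * s) -
          Real.exp (2 * t) • v (α * t)‖ := by fun_prop
      have h3 := (h2.tendsto t).mono_left (nhdsWithin_le_nhds (s := Set.Ici 0))
      simpa using h3
    refine squeeze_zero (fun s => Real.sqrt_nonneg _) (fun s => ?_) h1
    have h4 := (hc (Real.exp (2 * s) • v (α * s) - Real.exp (2 * t) • v (α * t))).2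
    rwa [map_sub, map_sub] at h4
  · simp [waveform]
  · obtain ⟨V, hVc, hVv⟩ := h.exists_regular preservesRegularity_burgers (continuous_growth α)
    have hτ : 0 < α * t := mul_pos hα ht
    set x : Seq := Real.exp (2 * t) • v (α * t) with hx
    set y : Seq := Real.exp (2 * t) • V (α * t) with hy
    have hxy : x = divFreq y := by rw [hx, hy, map_smul, hVv _ hτ]
    refine ⟨-(α • -sineSeries y) - (2 : ℝ) • waveform α v t, α • productL2 x x,
      ⟨isOdd_sineSeries _, cosineSeries x, -sineSeries y, hasWeakDeriv_sineSeries x, ?_, rfl⟩,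
      ⟨cosineSeries x, hasWeakDeriv_sineSeries x, coeFn_smul_productL2 α x⟩, ?_⟩
    · rw [hxy]
      exact hasWeakDeriv_cosineSeries y
    · have hd := h.hasDerivAt_divFreq (continuous_growth α) hVc hVv hτ
      have hlin : HasDerivAt (fun s : ℝ => α * s) α t := by
        simpa using (hasDerivAt_id t).const_mul α
      have hd2 : HasDerivAt (fun s => divFreq (v (α * s)))
          (α • (-V (α * t) + growth α (α * t) • burgers (v (α * t)) (v (α * t)))) t :=
        HasDerivAt.scomp t hd hlin
      have hexp : HasDerivAt (fun s : ℝ => Real.exp (2 * s)) (2 * Real.exp (2 * t)) t := by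
        have := ((hasDerivAt_id t).const_mul 2).exp
        refine this.congr_deriv ?_
        simp only [id]
        ring
      have hd3 := hexp.smul hd2
      have hd4 := sineSeries.toContinuousLinearMap.hasFDerivAt.comp_hasDerivAt t hd3
      have hw : waveform α v = sineSeries.toContinuousLinearMap ∘
          fun s => Real.exp (2 * s) • divFreq (v (α * s)) := by
        funext s
        simp only [waveform, map_smul, Function.comp_apply]
        rfl
      rw [hw]
      refine hd4.congr_deriv ?_
      -- The coefficient at rescaled time equals the amplitude, so it supplies the second factor
      -- e^{2t} of the quadratic term.
      have hg : growth α (α * t) = Real.exp (2 * t) := by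
        rw [growth]
        congr 1
        field_simp
      rw [hg, ← sineSeries_burgers, Function.comp_apply]
      change sineSeries _ = α • sineSeries _ - (-(α • -sineSeries y) - (2 : ℝ) • sineSeries _)
      simp only [← map_smul, ← map_neg, ← map_sub]
      congr 1
      rw [hx, hy]
      simp only [map_smul, smul_apply, smul_add, smul_neg, smul_smul]
      module

/-- The sine coefficients of a solution satisfy the Burgers system of ordinary differential
equations. -/
theorem hasDerivAt_of_equation {α : ℝ} {y : ℝ → L2} {u : ℝ → Seq}
    (hu : ∀ t, 0 < t → y t = sineSeries (divFreq (u t))) {t : ℝ} (ht : 0 < t) {Az Fz : L2}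
    (hA : OpA α (y t) Az) (hF : NonlinF α (y t) Fz) (hd : HasDerivAt y (Fz - Az) t) (n : ℕ) :
    HasDerivAt (fun s => u s n) (-(α * freq n ^ 2 - 2) * u t n +
      freq n * (α * burgers (u t) (u t) n)) t := by
  obtain ⟨-, z₁, z₂, h1, h2, rfl⟩ := hA
  obtain ⟨z₁', h1', h3⟩ := hF
  have hz₁' : z₁' = cosineSeries (u t) := by
    rw [hu t ht] at h1'
    exact h1'.unique (hasWeakDeriv_sineSeries _)
  have hFz : Fz = α • productL2 (u t) (u t) := by
    apply Lp.ext
    filter_upwards [h3, coeFn_smul_productL2 α (u t)] with x h4 h5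
    rw [h4, h5, hz₁', hu t ht]
  have hcoef : ∀ s, 0 < s → inner ℝ (toL2 (sinB n)) (y s) = u s n / freq n := fun s hs => by
    rw [hu s hs, inner_sinB_sineSeries_divFreq]
  have hz₂ : inner ℝ (toL2 (sinB n)) z₂ = -(freq n * (freq n * (u t n / freq n))) := by
    rw [h2.inner_sinB, h1.inner_cosB, hcoef t ht]
  have hd1 : HasDerivAt (fun s => inner ℝ (toL2 (sinB n)) (y s))
      (inner ℝ (toL2 (sinB n)) (Fz - (-(α • z₂) - (2 : ℝ) • y t))) t :=
    (innerSL ℝ (toL2 (sinB n))).hasFDerivAt.comp_hasDerivAt t hd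
  have hd2 := hd1.const_mul (freq n)
  have heq : (fun s => u s n) =ᶠ[𝓝 t] fun s => freq n * inner ℝ (toL2 (sinB n)) (y s) := by
    filter_upwards [lt_mem_nhds ht] with s hs
    rw [hcoef s hs, mul_div_cancel₀ _ (freq_ne_zero n)]
  refine (hd2.congr_of_eventuallyEq heq).congr_deriv ?_
  rw [hFz, inner_sub_right, inner_sub_right, inner_neg_right, inner_smul_right, inner_smul_right,
    inner_smul_right, hz₂, hcoef t ht, ← sineCoeffs_apply, ← burgers_apply]
  have key : ∀ k x b : ℝ, k ≠ 0 → k * (α * b - (-(α * -(k * (k * (x / k)))) - 2 * (x / k))) =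
      -(α * k ^ 2 - 2) * x + k * (α * b) := by
    intro k x b hk
    field_simp
    ring
  exact key _ _ _ (freq_ne_zero n)

/-- Norm equivalence turns continuity in 𝓑^{1/2} into continuity in ℓ². Pairing the equation with
each sine gives the mode equations, and undoing the amplitude and time scaling produces a flow. -/
theorem IsSolution.exists_isFlow {αr a α : ℝ} (hαr : 0 < αr) (ha : 2 - αr < a) (hα : 0 < α)
    {z₀ : L2} {y : ℝ → L2} (h : IsSolution αr a α z₀ y) :
    ∃ v, IsFlow burgers (growth α) v ∧ ∀ t, 0 ≤ t → y t = waveform α v t := by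
  have hex : ∀ t, ∃ x, y (max t 0) = sineSeries (divFreq x) := fun t =>
    (mem_fracSpace_iff hαr ha).1 (h.mem _ (le_max_right _ _))
  choose u hu using hex
  have hu0 : ∀ t, 0 ≤ t → y t = sineSeries (divFreq (u t)) := fun t ht => by
    rw [← hu t, max_eq_left ht]
  have huc : Continuous u := by
    refine continuous_iff_continuousAt.2 fun t => ?_
    obtain ⟨c₁, c₂, h1, -, hc⟩ := exists_fracNorm_bounds hαr ha
    have h2 := h.continuous (max t 0) (le_max_right _ _)
    have h3 : Tendsto (fun s : ℝ => max s 0) (𝓝 t) (𝓝[Set.Ici 0] (max t 0)) :=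
      tendsto_nhdsWithin_iff.2 ⟨(continuous_id.max continuous_const).tendsto t,
        Eventually.of_forall fun s => Set.mem_Ici.2 (le_max_right s 0)⟩
    have h4 := (h2.comp h3).div_const c₁
    rw [zero_div] at h4
    rw [ContinuousAt, tendsto_iff_norm_sub_tendsto_zero]
    refine squeeze_zero (fun s => norm_nonneg _) (fun s => ?_) h4
    rw [le_div_iff₀' h1, Function.comp_apply, hu s, hu t, ← map_sub, ← map_sub]
    exact (hc _).1
  set v : ℝ → Seq := fun τ => Real.exp (-2 * τ / α) • u (τ / α) with hv
  have hvc : Continuous v := by fun_prop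
  refine ⟨v, ⟨hvc, fun τ hτ n => ?_⟩, fun t ht => ?_⟩
  · have ht : 0 < τ / α := div_pos hτ hα
    obtain ⟨Az, Fz, hA, hF, hd⟩ := h.equation (τ / α) ht
    have h1 := hasDerivAt_of_equation (fun t ht => hu0 t ht.le) ht hA hF hd n
    have h2 : HasDerivAt (fun s : ℝ => s / α) (1 / α) τ := (hasDerivAt_id τ).div_const α
    have h3 := h1.scomp τ h2
    have h4 : HasDerivAt (fun s : ℝ => Real.exp (-2 * s / α))
        (Real.exp (-2 * τ / α) * (-2 * 1 / α)) τ :=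
      (((hasDerivAt_id τ).const_mul (-2)).div_const α).exp
    refine (h4.mul h3).congr_deriv ?_
    have h5 : growth α τ * Real.exp (-2 * τ / α) = 1 := by
      rw [growth, ← Real.exp_add, ← add_div]
      simp
    simp only [hv, map_smul, smul_apply, Seq.smul_apply, Function.comp_apply, smul_eq_mul]
    have key : ∀ e g k x b : ℝ, g * e = 1 → e * (-2 * 1 / α) * x +
        e * (1 / α * (-(α * k ^ 2 - 2) * x + k * (α * b))) =
        -k ^ 2 * (e * x) + k * (g * (e * (e * b))) := by
      intro e g k x b he
      have h6 : g * (e * (e * b)) = e * b := by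
        rw [← mul_assoc, he, one_mul]
      rw [h6]
      field_simp
      ring
    exact key _ _ _ _ _ h5
  · rw [hu0 t ht, waveform]
    congr 2
    simp only [hv]
    rw [smul_smul, ← Real.exp_add, mul_div_cancel_left₀ _ hα.ne']
    have h1 : 2 * t + -2 * (α * t) / α = 0 := by
      field_simp
      ring
    rw [h1, Real.exp_zero, one_smul]

/-! ### Joint continuity in the parameter and the initial value. -/

theorem abs_exp_sub_exp_le {s t m : ℝ} (hs : s ≤ m) (ht : t ≤ m) :
    |Real.exp s - Real.exp t| ≤ Real.exp m * |s - t| := by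
  wlog h : t ≤ s generalizing s t
  · rw [abs_sub_comm, abs_sub_comm s t]
    exact this ht hs (le_of_not_ge h)
  rw [abs_of_nonneg (sub_nonneg.2 (Real.exp_le_exp.2 h)), abs_of_nonneg (sub_nonneg.2 h)]
  have h1 : Real.exp t = Real.exp s * Real.exp (t - s) := by
    rw [← Real.exp_add]
    congr 1
    ring
  have h2 := Real.add_one_le_exp (t - s)
  calc Real.exp s - Real.exp t ≤ Real.exp s * (s - t) := by
        rw [h1]
        nlinarith [Real.exp_pos s]
    _ ≤ Real.exp m * (s - t) :=
        mul_le_mul_of_nonneg_right (Real.exp_le_exp.2 hs) (sub_nonneg.2 h)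

/-- Joint continuity of the rescaled flow in the parameter and the initial value. -/
theorem tendsto_flow {F : ℝ → Seq → ℝ → Seq}
    (hF : ∀ α, 0 < α → ∀ x, IsFlow burgers (growth α) (F α x))
    (hF0 : ∀ α, 0 < α → ∀ x, F α x 0 = x) {t α₀ : ℝ} (ht : 0 ≤ t) (hα₀ : 0 < α₀) (x₀ : Seq) :
    Tendsto (fun p : ℝ × Seq => F p.1 p.2 (p.1 * t)) (𝓝 (α₀, x₀)) (𝓝 (F α₀ x₀ (α₀ * t))) := by
  -- For α between α₀/2 and 2α₀ the rescaled time αt stays below T and the coefficient stays below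
  -- γ; M is the resulting a priori bound for initial values of norm at most ρ.
  set T : ℝ := 2 * α₀ * t with hT
  have hT0 : 0 ≤ T := by positivity
  set ρ : ℝ := ‖x₀‖ + 1 with hρ
  set γ : ℝ := Real.exp (2 * T / (α₀ / 2)) with hγ
  set M : ℝ := ρ * Real.exp (‖burgers‖ ^ 2 * γ ^ 2 * ρ ^ 2 / 4) with hM
  have hρ0 : 0 ≤ ρ := by positivity
  have hgrow : ∀ α, α₀ / 2 < α → ∀ s ∈ Set.Icc 0 T, 2 * s / α ≤ 2 * T / (α₀ / 2) :=
    fun α hα s hs => by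
      have h1 : 0 < α := by linarith
      have := hs.2
      gcongr
  have hbound : ∀ α, α₀ / 2 < α → ∀ x : Seq, ‖x‖ ≤ ρ → ∀ s ∈ Set.Icc 0 T, ‖F α x s‖ ≤ M := by
    intro α hα x hx s hs
    have hα0 : 0 < α := by linarith
    have h1 := (hF α hα0 x).norm_sq_le inner_divFreq_burgers (continuous_growth α) hs.1 (γ := γ)
      fun r hr => by
        rw [abs_of_pos (growth_pos _ _)]
        exact Real.exp_le_exp.2 (hgrow α hα r ⟨hr.1, hr.2.trans hs.2⟩)
    rw [hF0 α hα0] at h1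
    refine abs_le_of_sq_le_sq' (h1.trans ?_) (by positivity) |>.2
    rw [hM, mul_pow, ← Real.exp_nat_mul (‖burgers‖ ^ 2 * γ ^ 2 * ρ ^ 2 / 4) 2]
    have h2 : ‖burgers‖ ^ 2 * γ ^ 2 * ‖x‖ ^ 2 / 2 ≤
        ((2 : ℕ) : ℝ) * (‖burgers‖ ^ 2 * γ ^ 2 * ρ ^ 2 / 4) := by
      have h3 : ‖burgers‖ ^ 2 * γ ^ 2 * ‖x‖ ^ 2 ≤ ‖burgers‖ ^ 2 * γ ^ 2 * ρ ^ 2 := by gcongr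
      push_cast
      linarith
    gcongr
  set η : ℝ → ℝ := fun α => γ * |2 * T * (α⁻¹ - α₀⁻¹)| with hη
  set b : ℝ × Seq → ℝ := fun p =>
    √((‖p.2 - x₀‖ ^ 2 + p.1 * t * (2 * η p.1 ^ 2 * ‖burgers‖ ^ 2 * M ^ 4)) *
      Real.exp (p.1 * t * (8 * γ ^ 2 * ‖burgers‖ ^ 2 * M ^ 2))) with hb
  -- Both flows are compared at the same rescaled time αt. The remaining change from αt to α₀t
  -- concerns one fixed flow and is handled by its continuity in time.
  have hclose : ∀ᶠ p in 𝓝 (α₀, x₀), ‖F p.1 p.2 (p.1 * t) - F α₀ x₀ (p.1 * t)‖ ≤ b p := by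
    have e1 : ∀ᶠ p : ℝ × Seq in 𝓝 (α₀, x₀), p.1 ∈ Set.Ioo (α₀ / 2) (2 * α₀) :=
      continuous_fst.tendsto (α₀, x₀) (Ioo_mem_nhds (by simp only; linarith) (by simp only; linarith))
    have e2 : ∀ᶠ p : ℝ × Seq in 𝓝 (α₀, x₀), ‖p.2‖ < ρ :=
      (continuous_snd.norm.tendsto (α₀, x₀)).eventually_lt_const (by simp only [hρ]; linarith)
    filter_upwards [e1, e2] with p h1 h2
    have hp0 : 0 < p.1 := by linarith [h1.1]
    have hpt : 0 ≤ p.1 * t := by positivity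
    have hpT : p.1 * t ≤ T := mul_le_mul_of_nonneg_right h1.2.le ht
    have hsub : ∀ s ∈ Set.Icc 0 (p.1 * t), s ∈ Set.Icc 0 T := fun s hs =>
      ⟨hs.1, hs.2.trans hpT⟩
    have h3 := (hF p.1 hp0 p.2).norm_sub_sq_le (hF α₀ hα₀ x₀) (continuous_growth _)
      (continuous_growth _) hpt (γ := γ) (η := η p.1) (M := M)
      (fun s hs => by
        rw [abs_of_pos (growth_pos _ _)]
        exact Real.exp_le_exp.2 (hgrow _ h1.1 s (hsub s hs)))
      (fun s hs => by
        refine (abs_exp_sub_exp_le (hgrow _ h1.1 s (hsub s hs))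
          (hgrow α₀ (by linarith) s (hsub s hs))).trans ?_
        simp only [hη]
        refine mul_le_mul_of_nonneg_left ?_ (Real.exp_pos _).le
        rw [div_eq_mul_inv, div_eq_mul_inv, ← mul_sub, abs_mul, abs_mul (2 * T),
          abs_of_nonneg (show 0 ≤ 2 * s by linarith [hs.1]),
          abs_of_nonneg (show 0 ≤ 2 * T by linarith)]
        refine mul_le_mul_of_nonneg_right ?_ (abs_nonneg _)
        linarith [(hsub s hs).2])
      (fun s hs => hbound _ h1.1 _ h2.le s (hsub s hs))
      (fun s hs => hbound α₀ (by linarith) _ (by simp only [hρ]; linarith) s (hsub s hs))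
    rw [hF0 _ hp0, hF0 _ hα₀] at h3
    exact Real.le_sqrt_of_sq_le h3
  have hb0 : Tendsto b (𝓝 (α₀, x₀)) (𝓝 0) := by
    have hηc : ContinuousAt (fun p : ℝ × Seq => η p.1) (α₀, x₀) := by
      have h1 : ContinuousAt (fun p : ℝ × Seq => p.1⁻¹) (α₀, x₀) :=
        continuousAt_fst.inv₀ hα₀.ne'
      simp only [hη]
      fun_prop
    have h2 : ContinuousAt b (α₀, x₀) := by
      simp only [hb]
      fun_prop (disch := exact hα₀.ne')
    have h3 : b (α₀, x₀) = 0 := by simp [hb, hη]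
    rw [← h3]
    exact h2
  have h1 : Tendsto (fun p : ℝ × Seq => F p.1 p.2 (p.1 * t) - F α₀ x₀ (p.1 * t))
      (𝓝 (α₀, x₀)) (𝓝 0) := squeeze_zero_norm' hclose hb0
  have h2 : Tendsto (fun p : ℝ × Seq => F α₀ x₀ (p.1 * t)) (𝓝 (α₀, x₀))
      (𝓝 (F α₀ x₀ (α₀ * t))) := by
    have h3 : Continuous fun p : ℝ × Seq => F α₀ x₀ (p.1 * t) :=
      (hF α₀ hα₀ x₀).cont.comp (continuous_fst.mul continuous_const)
    exact h3.tendsto (α₀, x₀)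
  have h3 := h1.add h2
  simpa using h3

end HierCoulomb

/-! ### Well-posedness in 𝓑^{1/2}. -/

theorem theorem3p2 (αr a : ℝ) (hαr : 0 < αr) (ha : 2 - αr < a) :
    ∃ Z : ℝ → L2 → ℝ → L2,
      (∀ α : ℝ, 0 < α → ∀ z₀ ∈ fracSpace αr a (1 / 2),
        IsSolution αr a α z₀ (Z α z₀) ∧
        ∀ y : ℝ → L2, IsSolution αr a α z₀ y → ∀ t : ℝ, 0 ≤ t → y t = Z α z₀ t) ∧
      ∀ t : ℝ, 0 ≤ t → ∀ α₀ : ℝ, 0 < α₀ → ∀ z₀ ∈ fracSpace αr a (1 / 2),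
        ∀ ε : ℝ, 0 < ε → ∃ δ : ℝ, 0 < δ ∧
          ∀ α : ℝ, 0 < α → ∀ z ∈ fracSpace αr a (1 / 2),
            |α - α₀| < δ → fracNorm αr a (1 / 2) (z - z₀) < δ →
              fracNorm αr a (1 / 2) (Z α z t - Z α₀ z₀ t) < ε := by
  choose! F hF hF0 using fun (α : ℝ) (hα : 0 < α) (x : Seq) =>
    exists_isFlow inner_divFreq_burgers (continuous_growth α) (monotone_growth hα)
      (fun τ => (growth_pos α τ).le) x
  choose! X hX using fun (z : L2) (hz : z ∈ fracSpace αr a (1 / 2)) =>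
    (mem_fracSpace_iff hαr ha).1 hz
  refine ⟨fun α z => waveform α (F α (X z)), fun α hα z₀ hz₀ => ⟨?_, fun y hy t ht => ?_⟩, ?_⟩
  · have h1 := isSolution_waveform hαr ha hα (hF α hα (X z₀))
    rwa [hF0 α hα, ← hX z₀ hz₀] at h1
  · obtain ⟨v, hv, hvy⟩ := hy.exists_isFlow hαr ha hα
    have h0 : v 0 = F α (X z₀) 0 := by
      rw [hF0 α hα]
      refine sineSeries_divFreq_injective ?_
      have h1 := hvy 0 le_rfl
      rw [hy.initial, hX z₀ hz₀] at h1
      simp only [waveform, mul_zero, Real.exp_zero, one_smul] at h1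
      exact h1.symm
    rw [hvy t ht]
    simp only [waveform]
    rw [hv.eq_of_eq_zero (hF α hα (X z₀)) (continuous_growth α) h0 (mul_nonneg hα.le ht)]
  · intro t ht α₀ hα₀ z₀ hz₀ ε hε
    obtain ⟨c₁, c₂, h1, h2, hc⟩ := exists_fracNorm_bounds hαr ha
    have hcont := (tendsto_flow hF hF0 ht hα₀ (X z₀)).const_smul (Real.exp (2 * t))
    have hη : 0 < ε / c₂ := div_pos hε h2
    obtain ⟨δ, hδ, hball⟩ := Metric.tendsto_nhds_nhds.1 hcont (ε / c₂) hη
    -- The factor c₁ converts closeness in the graph norm into closeness in ℓ², just as ε / c₂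
    -- converts back.
    refine ⟨min δ (c₁ * δ), lt_min hδ (mul_pos h1 hδ), fun α hα z hz hαδ hzδ => ?_⟩
    have hzx : ‖X z - X z₀‖ < δ := by
      have h3 := (hc (X z - X z₀)).1
      rw [map_sub, map_sub, ← hX z hz, ← hX z₀ hz₀] at h3
      exact lt_of_mul_lt_mul_left (h3.trans_lt (hzδ.trans_le (min_le_right _ _))) h1.le
    have h4 := @hball (α, X z) (by
      rw [Prod.dist_eq, max_lt_iff, Real.dist_eq, dist_eq_norm]
      exact ⟨hαδ.trans_le (min_le_left _ _), hzx⟩)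
    rw [dist_eq_norm, lt_div_iff₀' h2] at h4
    refine lt_of_le_of_lt ?_ h4
    simp only [waveform]
    rw [← map_sub, ← map_sub]
    exact (hc _).2
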